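/- Let $G=(V,E)$ be a finite connected graph (loops and parallel edges allowed) with edge lengths $\ell_e>0$, and let $\Gamma$ be the associated metric graph, obtained by gluing intervals $[0,\ell_e]$, $e\in E$, along their ends according to $G$. A divisor on $\Gamma$ is a finite formal sum $D=\sum_{x\in\Gamma}D(x)(x)$ with $D(x)\in\mathbb Z$, of degree $\sum_x D(x)$. A rational function on $\Gamma$ is a continuous function $f\colon\Gamma\to\mathbb R$ that is piecewise affine with integral slopes on each edge; its divisor has coefficient at $x$ equal to the sum of the incoming slopes of $f$ at $x$. Two divisors are linearly equivalent if their difference is the divisor of a rational function. A divisor $D$ is $G$-admissible if on the interior of each edge all its coefficients are $0$, with at most one exception, where the coefficient is $1$. For $I\subseteq V$ let $\Gamma_I\subseteq\Gamma$ consist of the vertices in $I$ and of all points on edges with both extremities in $I$, let $\deg(D_I)=\sum_{x\in\Gamma_I}D(x)$, and let $e(I,I^c)$ be the number of edges joining $I$ to $I^c=V\setminus I$. For $d\in\mathbb Z$ let $H_d=\{q\in\mathbb R^V : \sum_{v\in V}q(v)=d\}$. The semistability polytope of a $G$-admissible divisor $D$ of degree $d$ is $$P_D=\Bigl\{q\in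 H_d : \Bigl|\deg(D_I)-\sum_{v\in I}q(v)\Bigr|\le \tfrac12\, e(I,I^c)\ \text{ for all }\ \emptyset\subsetneq I\subsetneq V\Bigr\}.$$ For an additive subgroup $\Lambda\subseteq\mathbb R$ containing all the $\ell_e$, a divisor is $\Lambda$-rational if every point of its support lies at a distance in $\Lambda$, measured along the edge containing it, from the ends of that edge. Theorem. Let $\mathcal L$ be a linear equivalence class of divisors of degree $d$ on $\Gamma$. Let $\Lambda\subseteq\mathbb R$ be an additive subgroup that contains all the edge lengths $\ell_e$ and is dense in $\mathbb R$, and assume that $\mathcal L$ contains a $\Lambda$-rational divisor. Then the collection of polytopes $$\mathcal T_\Lambda=\{P_D : D\in\mathcal L \text{ is } G\text{-admissible and } \Lambda\text{-rational}\}$$ is a tiling of $H_d$: its members are nonempty polytopes (of possibly different dimensions), their union is $H_d$, any two of them intersect in a common (possibly empty) face of both, and every compact subset of $H_d$ meets only finitely many of them. Moreover the tiling does not depend on $\Lambda$: if $\Lambda'$ is another subgroup satisfying the same hypotheses, then $\mathcal T_{\Lambda'}=\mathcal T_\Lambda$. -/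

import Mathlib

/-- A finite graph `G` (loops and parallel edges allowed) with vertices `V` and edges `E`, together
with an edge length function. The choice of a tail and a head for every edge is only used to
parametrize the edge `e` by the interval `[0, len e]`. -/
structure GraphModel (V E : Type*) where
  tail : E → V
  head : E → V
  len : E → ℝ
  len_pos : ∀ e, 0 < len e

namespace GraphModel

variable {V E : Type*}

/-- Connectedness of the graph `G` underlying the model. -/
def IsConnected (G : GraphModel V E) : Prop :=
  (SimpleGraph.fromRel fun u v : V => ∃ e : E, G.tail e = u ∧ G.head e = v).Connected

/-- The points of the metric graph `Γ` with model `(G, len)`: the vertices of `G`, and the points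
`x_t^e` with `0 < t < len e` of the interior of each edge `e`. -/
inductive Point (G : GraphModel V E) where
  | vertex (v : V) : Point G
  | inner (e : E) (t : Set.Ioo (0 : ℝ) (G.len e)) : Point G

open Classical in
/-- The point `x_t^e` at distance `t ∈ [0, len e]` from the tail of `e` along `e`
(for other real `t`, the nearest end of the edge). -/
noncomputable def edgePoint (G : GraphModel V E) (e : E) (t : ℝ) : G.Point :=
  if h : 0 < t ∧ t < G.len e then Point.inner e ⟨t, h⟩
  else if t ≤ 0 then Point.vertex (G.tail e) else Point.vertex (G.head e)

/-- The topology of `Γ`: the intervals `[0, len e]` are glued along their ends. -/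
noncomputable instance (G : GraphModel V E) : TopologicalSpace G.Point :=
  ⨆ e : E, TopologicalSpace.coinduced
    (fun t : Set.Icc (0 : ℝ) (G.len e) => G.edgePoint e t) inferInstance

/-- Divisors on `Γ`: the free abelian group on the points of `Γ`. -/
abbrev Divisor (G : GraphModel V E) := G.Point →₀ ℤ

/-- `g` is piecewise affine with integral slopes on `[0, l]`: there are finitely many break points
such that `g` is affine with integral slope on each subinterval without break points inside. -/
def IsPiecewiseAffine (l : ℝ) (g : ℝ → ℝ) : Prop :=
  ∃ S : Set ℝ, S.Finite ∧ ∀ a b : ℝ, 0 ≤ a → b ≤ l → Disjoint (Set.Ioo a b) S →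
    ∃ (m : ℤ) (c : ℝ), ∀ t ∈ Set.Icc a b, g t = m * t + c

/-- The restriction of `f : Γ → ℝ` to the edge `e`, in the coordinate `t ∈ [0, len e]`. -/
noncomputable def onEdge (G : GraphModel V E) (f : G.Point → ℝ) (e : E) : ℝ → ℝ :=
  fun t => f (G.edgePoint e t)

/-- Rational functions on `Γ`. -/
def IsRational (G : GraphModel V E) (f : G.Point → ℝ) : Prop :=
  Continuous f ∧ ∀ e, IsPiecewiseAffine (G.len e) (G.onEdge f e)

/-- Slope of `g` at `t` in the direction coming into `t` from the right. -/
noncomputable def slopeFromRight (g : ℝ → ℝ) (t : ℝ) : ℝ := -derivWithin g (Set.Ioi t) t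

/-- Slope of `g` at `t` in the direction coming into `t` from the left. -/
noncomputable def slopeFromLeft (g : ℝ → ℝ) (t : ℝ) : ℝ := derivWithin g (Set.Iio t) t

open Classical in
/-- The order of vanishing of `f` at a point of `Γ`: the sum of the incoming slopes. A loop at a
vertex contributes both of its ends. -/
noncomputable def ord [Fintype E] (G : GraphModel V E) (f : G.Point → ℝ) : G.Point → ℝ
  | Point.vertex v =>
      (∑ e : E, if G.tail e = v then slopeFromRight (G.onEdge f e) 0 else 0) +
        ∑ e : E, if G.head e = v then slopeFromLeft (G.onEdge f e) (G.len e) else 0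
  | Point.inner e t => slopeFromLeft (G.onEdge f e) t + slopeFromRight (G.onEdge f e) t

/-- Linear equivalence: `D₁ - D₂` is the divisor of a rational function. -/
def LinEquiv [Fintype E] (G : GraphModel V E) (D₁ D₂ : G.Divisor) : Prop :=
  ∃ f : G.Point → ℝ, G.IsRational f ∧ ∀ x, (((D₁ - D₂) x : ℤ) : ℝ) = G.ord f x

/-- The degree of a divisor. -/
def deg (G : GraphModel V E) (D : G.Divisor) : ℤ := D.sum fun _ n => n

/-- `L` is a linear equivalence class of divisors of degree `d`. -/
def IsLinearClass [Fintype E] (G : GraphModel V E) (d : ℤ) (L : Set G.Divisor) : Prop :=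
  ∃ D₀ : G.Divisor, G.deg D₀ = d ∧ L = {D | G.LinEquiv D D₀}

/-- `G`-admissible divisors: on the interior of each edge all coefficients are `0`, except for
at most one point, where the coefficient is `1`. -/
def IsAdmissible (G : GraphModel V E) (D : G.Divisor) : Prop :=
  ∀ e : E, (∀ t, D (Point.inner e t) = 0 ∨ D (Point.inner e t) = 1) ∧
    ∀ s t, D (Point.inner e s) ≠ 0 → D (Point.inner e t) ≠ 0 → s = t

/-- `Λ`-rational divisors, for a subgroup `Λ` of `ℝ` that contains all edge lengths: all points of
the support have coordinates in `Λ` (automatic for the vertices). -/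
def IsLambdaRational (G : GraphModel V E) (Λ : AddSubgroup ℝ) (D : G.Divisor) : Prop :=
  ∀ (e : E) (t : Set.Ioo (0 : ℝ) (G.len e)), D (Point.inner e t) ≠ 0 → (t : ℝ) ∈ Λ

/-- `Γ_I`: the vertices in `I` and all points on edges with both extremities in `I`. -/
def region (G : GraphModel V E) (I : Finset V) : Set G.Point :=
  {x | match x with
    | Point.vertex v => v ∈ I
    | Point.inner e _ => G.tail e ∈ I ∧ G.head e ∈ I}

open Classical in
/-- `deg(D_I)`, the sum of the coefficients of `D` at the points of `Γ_I`. -/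
noncomputable def degOn (G : GraphModel V E) (D : G.Divisor) (I : Finset V) : ℤ :=
  D.sum fun x n => if x ∈ G.region I then n else 0

open Classical in
/-- `e(I, Iᶜ)`, the number of edges between `I` and its complement. -/
noncomputable def cut [Fintype E] (G : GraphModel V E) (I : Finset V) : ℕ :=
  (Finset.univ.filter fun e : E => ¬(G.tail e ∈ I ↔ G.head e ∈ I)).card

/-- `H_d`, the functions `q : V → ℝ` of total sum `d`. -/
def degreeSpace (V : Type*) [Fintype V] (d : ℤ) : Set (V → ℝ) := {q | ∑ v, q v = d}

/-- `q`-semistability of `D`, for `q : V → ℝ`. -/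
def IsSemistable [Fintype V] [Fintype E] (G : GraphModel V E) (q : V → ℝ) (D : G.Divisor) : Prop :=
  q ∈ degreeSpace V (G.deg D) ∧ ∀ I : Finset V, I.Nonempty → I ≠ Finset.univ →
    |(G.degOn D I : ℝ) - ∑ v ∈ I, q v| ≤ (G.cut I : ℝ) / 2

/-- The semistability polytope `P_D`. -/
def semistabilityPolytope [Fintype V] [Fintype E] (G : GraphModel V E) (D : G.Divisor) :
    Set (V → ℝ) :=
  {q | G.IsSemistable q D}

/-- The collection of the polytopes `P_D` for `D` a `G`-admissible, `Λ`-rational divisor in `L`. -/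
def semistabilityTiles [Fintype V] [Fintype E] (G : GraphModel V E) (L : Set G.Divisor)
    (Λ : AddSubgroup ℝ) : Set (Set (V → ℝ)) :=
  {P | ∃ D ∈ L, G.IsAdmissible D ∧ G.IsLambdaRational Λ D ∧ P = G.semistabilityPolytope D}

end GraphModel

/-- A nonempty convex polytope in `ℝ^V`: a nonempty bounded intersection of finitely many closed
half-spaces (possibly of lower dimension). -/
def IsPolytope {V : Type*} [Fintype V] (P : Set (V → ℝ)) : Prop :=
  P.Nonempty ∧ Bornology.IsBounded P ∧
    ∃ s : Set (((V → ℝ) →ₗ[ℝ] ℝ) × ℝ), s.Finite ∧ P = {q | ∀ c ∈ s, c.1 q ≤ c.2}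

/-- A collection of polytopes is a tiling of `Ω` if its union is `Ω`, any two of its members meet in
a common face, and it is locally finite. `IsExposed ℝ P F` says that `F` is a face of `P`: the
empty set, or the set of maximizers on `P` of a linear form (with `P` itself for the form `0`). -/
structure IsTiling {V : Type*} [Fintype V] (T : Set (Set (V → ℝ))) (Ω : Set (V → ℝ)) : Prop where
  isPolytope : ∀ P ∈ T, IsPolytope P
  sUnion_eq : ⋃₀ T = Ω
  common_face : ∀ P ∈ T, ∀ Q ∈ T, IsExposed ℝ P (P ∩ Q) ∧ IsExposed ℝ Q (P ∩ Q)
  locallyFinite : ∀ K : Set (V → ℝ), IsCompact K → {P ∈ T | (P ∩ K).Nonempty}.Finite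

/-! Fix a `Λ`-rational `D₀` in `L`. An admissible divisor `D` of `L` is governed by the values `f :
V → ℝ` at the vertices of a rational function with divisor `D - D₀`. Put `x = slope D₀ f e`. When
`D₀` is supported at vertices, the function leaves the tail of `e` with slope `⌈x⌉` and enters the
head with slope `⌊x⌋`, the only possible chip being at distance `len e * fract x` from the tail; in
general `slope` and `base` absorb the interior chips of `D₀`. Every `f` occurs
(`LinEquiv.exists_hasPotential`, `exists_admissible_hasPotential`).

The function `energy` is convex and piecewise affine in `f`. The subdifferential of `profile` at `x`
is `[⌈x⌉ - 1/2, ⌊x⌋ + 1/2]`, so the derivative of `energy` along the indicator of `I` is the bound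
that semistability imposes on `I` (`energy_add_indicator`, `HasPotential.semistabilityPolytope_eq`).
A layer cake argument shows that indicators suffice, so `P_D` is the subdifferential `cell D₀ f`
(`cell_eq_cutCell`).

Subdifferentials of a convex function that grows quadratically modulo constants cover `H_d`: `q`
lies in the cell of a minimiser of `energy` minus the pairing with `q` (`exists_mem_cell`). Two
cells, at `f` and `g`, can only meet in the face where `g - f` is extremal (`isExposed_cell_inter`),
and bounded sets of `q` involve finitely many patterns of floors and ceilings
(`finite_cells_meeting`). A cell depends only on this pattern, and each pattern that occurs also
comes from a `Λ`-valued `f` (`exists_potential_mem`). Hence the tiles are all the cells, for every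
`Λ`. -/

namespace GraphModel

open Set Filter Topology
open scoped Classical

/-! ### One-sided slopes of piecewise affine functions -/

section Germs

/-- `g` is affine with slope `m` on a right neighbourhood of `t`. -/
def HasRightSlope (g : ℝ → ℝ) (m t : ℝ) : Prop := ∀ᶠ u in 𝓝[≥] t, g u = g t + m * (u - t)

/-- `g` is affine with slope `m` on a left neighbourhood of `t`. -/
def HasLeftSlope (g : ℝ → ℝ) (m t : ℝ) : Prop := ∀ᶠ u in 𝓝[≤] t, g u = g t + m * (u - t)

theorem hasDerivAt_affine (c m t x : ℝ) : HasDerivAt (fun u => c + m * (u - t)) m x := by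
  simpa using (((hasDerivAt_id x).sub_const t).const_mul m).const_add c

theorem HasRightSlope.slopeFromRight {g : ℝ → ℝ} {m t : ℝ} (h : HasRightSlope g m t) :
    slopeFromRight g t = -m := by
  have h1 : HasDerivWithinAt g m (Ioi t) t :=
    (hasDerivAt_affine (g t) m t t).hasDerivWithinAt.congr_of_eventuallyEq
      (h.filter_mono (nhdsWithin_mono _ Ioi_subset_Ici_self)) (by simp)
  rw [GraphModel.slopeFromRight, h1.derivWithin (uniqueDiffWithinAt_Ioi t)]

theorem HasLeftSlope.slopeFromLeft {g : ℝ → ℝ} {m t : ℝ} (h : HasLeftSlope g m t) :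
    slopeFromLeft g t = m := by
  have h1 : HasDerivWithinAt g m (Iio t) t :=
    (hasDerivAt_affine (g t) m t t).hasDerivWithinAt.congr_of_eventuallyEq
      (h.filter_mono (nhdsWithin_mono _ Iio_subset_Iic_self)) (by simp)
  rw [GraphModel.slopeFromLeft, h1.derivWithin (uniqueDiffWithinAt_Iio t)]

theorem HasRightSlope.add {g h : ℝ → ℝ} {m n t : ℝ} (hg : HasRightSlope g m t)
    (hh : HasRightSlope h n t) : HasRightSlope (fun u => g u + h u) (m + n) t := by
  filter_upwards [hg, hh] with u h1 h2
  rw [h1, h2]; ring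

theorem HasLeftSlope.add {g h : ℝ → ℝ} {m n t : ℝ} (hg : HasLeftSlope g m t)
    (hh : HasLeftSlope h n t) : HasLeftSlope (fun u => g u + h u) (m + n) t := by
  filter_upwards [hg, hh] with u h1 h2
  rw [h1, h2]; ring

theorem HasRightSlope.congr {g h : ℝ → ℝ} {m t b : ℝ} (hg : HasRightSlope g m t) (htb : t < b)
    (hgh : ∀ u ∈ Icc t b, h u = g u) : HasRightSlope h m t := by
  have : Icc t b ∈ 𝓝[≥] t := Icc_mem_nhdsGE htb
  filter_upwards [hg, this] with u h1 h2
  rw [hgh u h2, hgh t ⟨le_rfl, htb.le⟩, h1]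

theorem HasLeftSlope.congr {g h : ℝ → ℝ} {m t a : ℝ} (hg : HasLeftSlope g m t) (hat : a < t)
    (hgh : ∀ u ∈ Icc a t, h u = g u) : HasLeftSlope h m t := by
  have : Icc a t ∈ 𝓝[≤] t := Icc_mem_nhdsLE hat
  filter_upwards [hg, this] with u h1 h2
  rw [hgh u h2, hgh t ⟨hat.le, le_rfl⟩, h1]

theorem hasRightSlope_affine (c m t : ℝ) : HasRightSlope (fun u => c + m * u) m t :=
  Eventually.of_forall fun u => by ring

theorem hasLeftSlope_affine (c m t : ℝ) : HasLeftSlope (fun u => c + m * u) m t :=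
  Eventually.of_forall fun u => by ring

theorem IsPiecewiseAffine.exists_hasRightSlope {l : ℝ} {g : ℝ → ℝ} (hg : IsPiecewiseAffine l g)
    {t : ℝ} (h0 : 0 ≤ t) (hl : t < l) : ∃ m : ℤ, HasRightSlope g m t := by
  obtain ⟨S, hS, h⟩ := hg
  -- The point `t` may itself be a break point; only the others must be avoided.
  have h1 : (S \ {t})ᶜ ∈ 𝓝 t := (hS.subset sdiff_subset).isClosed.isOpen_compl.mem_nhds (by simp)
  obtain ⟨b, hb, hbS⟩ := exists_Ico_subset_of_mem_nhds h1 ⟨t + 1, by linarith⟩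
  have hmin : t < min b l := lt_min hb hl
  obtain ⟨m, c, hmc⟩ := h t (min b l) h0 (min_le_right _ _) (by
    rw [Set.disjoint_left]
    intro x hx hxS
    exact hbS ⟨hx.1.le, hx.2.trans_le (min_le_left _ _)⟩ ⟨hxS, hx.1.ne'⟩)
  refine ⟨m, (hasRightSlope_affine c m t).congr hmin fun u hu => ?_⟩
  rw [hmc u hu]; ring

theorem IsPiecewiseAffine.exists_hasLeftSlope {l : ℝ} {g : ℝ → ℝ} (hg : IsPiecewiseAffine l g)
    {t : ℝ} (h0 : 0 < t) (hl : t ≤ l) : ∃ m : ℤ, HasLeftSlope g m t := by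
  obtain ⟨S, hS, h⟩ := hg
  have h1 : (S \ {t})ᶜ ∈ 𝓝 t := (hS.subset sdiff_subset).isClosed.isOpen_compl.mem_nhds (by simp)
  obtain ⟨b, hb, hbS⟩ := exists_Ioc_subset_of_mem_nhds h1 ⟨t - 1, by linarith⟩
  have hmax : max b 0 < t := max_lt hb h0
  obtain ⟨m, c, hmc⟩ := h (max b 0) t (le_max_right _ _) hl (by
    rw [Set.disjoint_left]
    intro x hx hxS
    exact hbS ⟨(le_max_left _ _).trans_lt hx.1, hx.2.le⟩ ⟨hxS, hx.2.ne⟩)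
  refine ⟨m, (hasLeftSlope_affine c m t).congr hmax fun u hu => ?_⟩
  rw [hmc u hu]; ring

/-- A function on `[0, l]` that is affine on one-sided neighbourhoods, with no change of slope at
interior points, is affine. -/
theorem exists_affine_of_slopes {l : ℝ} (hl : 0 < l) {h : ℝ → ℝ} {m₀ m₁ : ℝ}
    (h0 : HasRightSlope h m₀ 0) (h1 : HasLeftSlope h m₁ l)
    (hin : ∀ t ∈ Ioo 0 l, ∃ m, HasLeftSlope h m t ∧ HasRightSlope h m t) :
    m₀ = m₁ ∧ h l = h 0 + m₀ * l := by
  have hloc : ∀ t ∈ Ioo 0 l, ∃ m, ∀ᶠ u in 𝓝 t, h u = h t + m * (u - t) := by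
    intro t ht
    obtain ⟨m, hL, hR⟩ := hin t ht
    refine ⟨m, ?_⟩
    rw [← nhdsLE_sup_nhdsGE t]
    exact eventually_sup.2 ⟨hL, hR⟩
  have hder : ∀ t ∈ Ioo 0 l, ∃ m, HasDerivAt h m t ∧ ∀ᶠ u in 𝓝 t, deriv h u = m := by
    intro t ht
    obtain ⟨m, hm⟩ := hloc t ht
    refine ⟨m, (hasDerivAt_affine (h t) m t t).congr_of_eventuallyEq hm, ?_⟩
    filter_upwards [hm.eventually_nhds] with u hu
    exact ((hasDerivAt_affine (h t) m t u).congr_of_eventuallyEq hu).deriv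
  have hdd : ∀ t ∈ Ioo 0 l, HasDerivAt (deriv h) 0 t := by
    intro t ht
    obtain ⟨m, -, hm⟩ := hder t ht
    exact (hasDerivAt_const t m).congr_of_eventuallyEq hm
  have hmid : l / 2 ∈ Ioo 0 l := ⟨by linarith, by linarith⟩
  set m := deriv h (l / 2) with hm
  have hconst : ∀ t ∈ Ioo 0 l, deriv h t = m := fun t ht =>
    isOpen_Ioo.is_const_of_deriv_eq_zero isPreconnected_Ioo
      (fun x hx => (hdd x hx).differentiableAt.differentiableWithinAt)
      (fun x hx => (hdd x hx).deriv) ht hmid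
  have hd : ∀ t ∈ Ioo 0 l, HasDerivAt (fun u => h u - m * u) 0 t := by
    intro t ht
    obtain ⟨k, hk, -⟩ := hder t ht
    have : k = m := by rw [← hconst t ht, hk.deriv]
    rw [this] at hk
    have hkm := hk.sub ((hasDerivAt_id t).const_mul m)
    rw [mul_one, sub_self] at hkm
    exact hkm
  have haff : ∀ t ∈ Ioo 0 l, h t = h (l / 2) + m * (t - l / 2) := by
    intro t ht
    have := isOpen_Ioo.is_const_of_deriv_eq_zero isPreconnected_Ioo
      (fun x hx => (hd x hx).differentiableAt.differentiableWithinAt)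
      (fun x hx => (hd x hx).deriv) ht hmid
    linarith
  -- Evaluating at two points identifies any affine expression of `h` on a subinterval with the
  -- global one. Applied to the end germs, it reaches `h 0` and `h l`, which lie outside the range
  -- of `haff`.
  have key : ∀ {p q k : ℝ} {a b : ℝ}, a < b → Ioo a b ⊆ Ioo 0 l →
      (∀ u ∈ Ioo a b, h u = p + k * (u - q)) → k = m ∧ p = h (l / 2) + m * (q - l / 2) := by
    intro p q k a b hab hsub hu
    have hx : a + (b - a) / 3 ∈ Ioo a b := ⟨by linarith, by linarith⟩
    have hy : a + 2 * (b - a) / 3 ∈ Ioo a b := ⟨by linarith, by linarith⟩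
    have e1 := hu _ hx
    have e2 := hu _ hy
    rw [haff _ (hsub hx)] at e1
    rw [haff _ (hsub hy)] at e2
    have hk : (k - m) * ((b - a) / 3) = 0 := by linarith
    have hk' : k = m := by
      rcases mul_eq_zero.1 hk with h | h
      · linarith
      · linarith
    subst hk'
    exact ⟨rfl, by linarith⟩
  obtain ⟨b, hb, hb'⟩ := (mem_nhdsGE_iff_exists_Ico_subset).1 h0
  have hb0 : (0 : ℝ) < b := hb
  obtain ⟨r1, r2⟩ := key (a := 0) (b := min b l) (lt_min hb0 hl)
    (Ioo_subset_Ioo_right (min_le_right _ _))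
    (fun u hu => hb' ⟨hu.1.le, hu.2.trans_le (min_le_left _ _)⟩)
  obtain ⟨a, ha, ha'⟩ := (mem_nhdsLE_iff_exists_Ioc_subset).1 h1
  have hal : a < l := ha
  obtain ⟨s1, s2⟩ := key (a := max a 0) (b := l) (max_lt hal hl)
    (Ioo_subset_Ioo_left (le_max_right _ _))
    (fun u hu => ha' ⟨(le_max_left _ _).trans_lt hu.1, hu.2.le⟩)
  exact ⟨r1.trans s1.symm, by rw [r2, s2, r1]; ring⟩

end Germs

variable {V E : Type*}

/-! ### Weighted sums of a divisor over an open edge -/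

section EdgeSum

/-- The function on `Γ` that equals `φ` in the coordinate of the interior of the edge `e`, and
vanishes elsewhere. -/
noncomputable def edgeCoeff (G : GraphModel V E) (e : E) (φ : ℝ → ℝ) : G.Point → ℝ
  | Point.vertex _ => 0
  | Point.inner e' t => if e' = e then φ t else 0

/-- The sum of `D(x) φ(x)` over the points of the interior of `e`. -/
noncomputable def edgeSum (G : GraphModel V E) (e : E) (φ : ℝ → ℝ) (D : G.Divisor) : ℝ :=
  ∑ x ∈ D.support, (D x : ℝ) * G.edgeCoeff e φ x

variable {G : GraphModel V E} {e : E}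

theorem sum_support_eq {D : G.Divisor} {s : Finset G.Point} (hs : D.support ⊆ s)
    (w : G.Point → ℝ) : ∑ x ∈ D.support, (D x : ℝ) * w x = ∑ x ∈ s, (D x : ℝ) * w x :=
  Finset.sum_subset hs fun x _ hx => by simp [Finsupp.notMem_support_iff.1 hx]

theorem edgeSum_sub (φ : ℝ → ℝ) (D D' : G.Divisor) :
    G.edgeSum e φ (D - D') = G.edgeSum e φ D - G.edgeSum e φ D' := by
  unfold edgeSum
  rw [sum_support_eq (s := D.support ∪ D'.support) Finsupp.support_sub,
    sum_support_eq (D := D) Finset.subset_union_left,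
    sum_support_eq (D := D') Finset.subset_union_right, ← Finset.sum_sub_distrib]
  refine Finset.sum_congr rfl fun x _ => ?_
  rw [Finsupp.sub_apply]; push_cast; ring

theorem edgeCoeff_congr {φ ψ : ℝ → ℝ} (h : ∀ s ∈ Ioo 0 (G.len e), φ s = ψ s) (x : G.Point) :
    G.edgeCoeff e φ x = G.edgeCoeff e ψ x := by
  cases x with
  | vertex v => rfl
  | inner e' t =>
    by_cases he : e' = e
    · subst he; simp only [edgeCoeff, if_true]; exact h t t.2
    · simp [edgeCoeff, he]

theorem edgeSum_congr {φ ψ : ℝ → ℝ} (h : ∀ s ∈ Ioo 0 (G.len e), φ s = ψ s) (D : G.Divisor) :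
    G.edgeSum e φ D = G.edgeSum e ψ D :=
  Finset.sum_congr rfl fun x _ => by rw [edgeCoeff_congr h]

theorem edgeSum_add_mul (φ ψ : ℝ → ℝ) (k : ℝ) (D : G.Divisor) :
    G.edgeSum e (fun s => φ s + k * ψ s) D = G.edgeSum e φ D + k * G.edgeSum e ψ D := by
  unfold edgeSum
  rw [Finset.mul_sum, ← Finset.sum_add_distrib]
  refine Finset.sum_congr rfl fun x _ => ?_
  cases x with
  | vertex v => simp [edgeCoeff]
  | inner e' t =>
    by_cases he : e' = e
    · simp only [edgeCoeff, he, if_true]; ring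
    · simp [edgeCoeff, he]

theorem edgeSum_zero (D : G.Divisor) : G.edgeSum e (fun _ => 0) D = 0 := by
  refine Finset.sum_eq_zero fun x _ => ?_
  cases x <;> simp [edgeCoeff]

theorem edgeSum_mem (Λ : AddSubgroup ℝ) {φ : ℝ → ℝ} {D : G.Divisor}
    (h : ∀ t, D (Point.inner e t) ≠ 0 → φ t ∈ Λ) : G.edgeSum e φ D ∈ Λ := by
  refine sum_mem fun x hx => ?_
  rw [← zsmul_eq_mul]
  refine Λ.zsmul_mem ?_ _
  cases x with
  | vertex v => exact Λ.zero_mem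
  | inner e' t =>
    by_cases he : e' = e
    · subst he; simpa [edgeCoeff] using h t (Finsupp.mem_support_iff.1 hx)
    · simp [edgeCoeff, he]

theorem exists_int_edgeSum {φ : ℝ → ℝ} (h : ∀ s, ∃ k : ℤ, φ s = k) (D : G.Divisor) :
    ∃ n : ℤ, G.edgeSum e φ D = n := by
  have : G.edgeSum e φ D ∈ (Int.castAddHom ℝ).range :=
    edgeSum_mem _ fun t _ => by obtain ⟨k, hk⟩ := h t; exact ⟨k, hk.symm⟩
  obtain ⟨n, hn⟩ := this
  exact ⟨n, hn.symm⟩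

theorem edgeSum_eq_of_forall_ne {D : G.Divisor} (φ : ℝ → ℝ) (t : Ioo (0 : ℝ) (G.len e))
    (h : ∀ s, s ≠ t → D (Point.inner e s) = 0) :
    G.edgeSum e φ D = D (Point.inner e t) * φ t := by
  unfold edgeSum
  rw [Finset.sum_eq_single (Point.inner e t)]
  · simp [edgeCoeff]
  · intro x _ hx
    cases x with
    | vertex v => simp [edgeCoeff]
    | inner e' s =>
      by_cases he : e' = e
      · subst he; rw [h s (fun hs => hx (by rw [hs]))]; simp
      · simp [edgeCoeff, he]
  · intro hx; simp [Finsupp.notMem_support_iff.1 hx]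

theorem edgeSum_eq_zero {D : G.Divisor} (φ : ℝ → ℝ) (h : ∀ s, D (Point.inner e s) = 0) :
    G.edgeSum e φ D = 0 := by
  rw [edgeSum_eq_of_forall_ne φ ⟨G.len e / 2, by have := G.len_pos e; constructor <;> linarith⟩
    (fun s _ => h s), h]
  simp

theorem edgeSum_indicator_eq (D : G.Divisor) (t : Ioo (0 : ℝ) (G.len e)) :
    G.edgeSum e (fun s => if s = t then 1 else 0) D = D (Point.inner e t) := by
  unfold edgeSum
  rw [Finset.sum_eq_single (Point.inner e t)]
  · simp [edgeCoeff]
  · intro x _ hx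
    cases x with
    | vertex v => simp [edgeCoeff]
    | inner e' s =>
      by_cases he : e' = e
      · subst he
        have : ¬ (s : ℝ) = t := fun hs => hx (by rw [Subtype.ext hs])
        simp [edgeCoeff, this]
      · simp [edgeCoeff, he]
  · intro hx; simp [Finsupp.notMem_support_iff.1 hx]

/-- The function of slope `0` at the tail of `e` whose divisor in the interior of `e` is `-D`. -/
noncomputable def ramp (G : GraphModel V E) (D : G.Divisor) (e : E) (u : ℝ) : ℝ :=
  G.edgeSum e (fun s => max (u - s) 0) D

theorem ramp_zero (D : G.Divisor) : G.ramp D e 0 = 0 := by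
  rw [ramp, edgeSum_congr (ψ := fun _ => 0), edgeSum_zero]
  intro s hs
  exact max_eq_right (by linarith [hs.1])

theorem ramp_len (D : G.Divisor) :
    G.ramp D e (G.len e) = G.len e * G.edgeSum e (fun _ => 1) D - G.edgeSum e id D := by
  rw [ramp, edgeSum_congr (ψ := fun s => (0 + G.len e * (fun _ => 1) s) + (-1) * id s),
    edgeSum_add_mul, edgeSum_add_mul (fun _ => 0), edgeSum_zero]
  · ring
  · intro s hs
    simp only [id]
    rw [max_eq_left (by linarith [hs.2])]; ring

theorem hasRightSlope_ramp (D : G.Divisor) (t : ℝ) :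
    HasRightSlope (G.ramp D e) (G.edgeSum e (fun s => if s ≤ t then 1 else 0) D) t := by
  have : ∀ x ∈ D.support, ∀ᶠ u in 𝓝[≥] t, G.edgeCoeff e (fun s => max (u - s) 0) x =
      G.edgeCoeff e (fun s => max (t - s) 0) x +
        G.edgeCoeff e (fun s => if s ≤ t then 1 else 0) x * (u - t) := by
    intro x _
    cases x with
    | vertex v => simp [edgeCoeff]
    | inner e' s =>
      by_cases he : e' = e
      · simp only [edgeCoeff, he, if_true]
        by_cases hs : (s : ℝ) ≤ t
        · filter_upwards [self_mem_nhdsWithin] with u hu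
          have : t ≤ u := hu
          rw [if_pos hs, max_eq_left (by linarith), max_eq_left (by linarith)]; ring
        · filter_upwards [mem_nhdsWithin_of_mem_nhds (Iio_mem_nhds (not_le.1 hs))] with u hu
          have : u < s := hu
          rw [if_neg hs, max_eq_right (by linarith), max_eq_right (by linarith)]; ring
      · simp [edgeCoeff, he]
  filter_upwards [(Filter.eventually_all_finset _).2 this] with u hu
  unfold ramp edgeSum
  rw [Finset.sum_mul, ← Finset.sum_add_distrib]
  refine Finset.sum_congr rfl fun x hx => ?_
  rw [hu x hx]; ring

theorem hasLeftSlope_ramp (D : G.Divisor) (t : ℝ) :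
    HasLeftSlope (G.ramp D e) (G.edgeSum e (fun s => if s < t then 1 else 0) D) t := by
  have : ∀ x ∈ D.support, ∀ᶠ u in 𝓝[≤] t, G.edgeCoeff e (fun s => max (u - s) 0) x =
      G.edgeCoeff e (fun s => max (t - s) 0) x +
        G.edgeCoeff e (fun s => if s < t then 1 else 0) x * (u - t) := by
    intro x _
    cases x with
    | vertex v => simp [edgeCoeff]
    | inner e' s =>
      by_cases he : e' = e
      · simp only [edgeCoeff, he, if_true]
        by_cases hs : (s : ℝ) < t
        · filter_upwards [mem_nhdsWithin_of_mem_nhds (Ioi_mem_nhds hs)] with u hu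
          have : s < u := hu
          rw [if_pos hs, max_eq_left (by linarith), max_eq_left (by linarith)]; ring
        · filter_upwards [self_mem_nhdsWithin] with u hu
          have : u ≤ t := hu
          rw [if_neg hs, max_eq_right (by linarith), max_eq_right (by linarith)]; ring
      · simp [edgeCoeff, he]
  filter_upwards [(Filter.eventually_all_finset _).2 this] with u hu
  unfold ramp edgeSum
  rw [Finset.sum_mul, ← Finset.sum_add_distrib]
  refine Finset.sum_congr rfl fun x hx => ?_
  rw [hu x hx]; ring

theorem edgeSum_le_sub_lt (D : G.Divisor) (t : Ioo (0 : ℝ) (G.len e)) :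
    G.edgeSum e (fun s => if s ≤ t then 1 else 0) D =
      G.edgeSum e (fun s => if s < t then 1 else 0) D + D (Point.inner e t) := by
  rw [← edgeSum_indicator_eq, edgeSum_congr
    (ψ := fun s => (if s < (t : ℝ) then 1 else 0) + 1 * (fun s => if s = (t : ℝ) then 1 else 0) s),
    edgeSum_add_mul]
  · ring
  · intro s _
    rcases lt_trichotomy s t with h | h | h
    · simp [h, h.le, h.ne]
    · simp [h]
    · simp [h.not_ge, h.not_gt, h.ne']

theorem edgeSum_le_zero (D : G.Divisor) :
    G.edgeSum e (fun s => if s ≤ 0 then 1 else 0) D = 0 := by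
  rw [edgeSum_congr (ψ := fun _ => 0), edgeSum_zero]
  intro s hs
  simp [hs.1]

theorem edgeSum_lt_len (D : G.Divisor) :
    G.edgeSum e (fun s => if s < G.len e then 1 else 0) D = G.edgeSum e (fun _ => 1) D :=
  edgeSum_congr (fun s hs => by simp [hs.2]) D

theorem isPiecewiseAffine_sub_ramp (D : G.Divisor) (a : ℝ) (m : ℤ) :
    IsPiecewiseAffine (G.len e) fun u => a + m * u - G.ramp D e u := by
  have hinj : Function.Injective (Point.inner e : _ → G.Point) := fun s t h => by
    injection h
  refine ⟨Subtype.val '' ((Point.inner e : _ → G.Point) ⁻¹' (D.support : Set G.Point)),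
    ((D.support.finite_toSet.preimage hinj.injOn).image _), ?_⟩
  intro b c hb hc hdisj
  obtain ⟨n, hn⟩ := exists_int_edgeSum (G := G) (e := e) (φ := fun s => if s ≤ b then 1 else 0)
    (fun s => by by_cases h : s ≤ b; exacts [⟨1, by simp [h]⟩, ⟨0, by simp [h]⟩]) D
  -- On `[b, c]` a chip at `s ≤ b` contributes `u - s` to the ramp; any other has `s ≥ c` and
  -- contributes `0`.
  refine ⟨m - n, a + G.edgeSum e (fun s => if s ≤ b then s else 0) D, fun u hu => ?_⟩
  have : G.ramp D e u = u * n - G.edgeSum e (fun s => if s ≤ b then s else 0) D := by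
    rw [← hn]
    unfold ramp edgeSum
    rw [Finset.mul_sum, ← Finset.sum_sub_distrib]
    refine Finset.sum_congr rfl fun x hx => ?_
    cases x with
    | vertex v => simp [edgeCoeff]
    | inner e' s =>
      by_cases he : e' = e
      · subst he
        simp only [edgeCoeff, if_true]
        by_cases hs : (s : ℝ) ≤ b
        · rw [if_pos hs, if_pos hs, max_eq_left (by linarith [hu.1])]; ring
        · have hcs : c ≤ s := by
            by_contra hcs
            exact Set.disjoint_left.1 hdisj ⟨not_le.1 hs, not_le.1 hcs⟩ ⟨s, hx, rfl⟩
          rw [if_neg hs, if_neg hs, max_eq_right (by linarith [hu.2])]; ring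
      · simp [edgeCoeff, he]
  simp only [this]; push_cast; ring

end EdgeSum

/-! ### Combinatorial description of principal divisors -/

theorem edgePoint_zero (G : GraphModel V E) (e : E) : G.edgePoint e 0 = Point.vertex (G.tail e) := by
  simp [edgePoint]

theorem edgePoint_len (G : GraphModel V E) (e : E) :
    G.edgePoint e (G.len e) = Point.vertex (G.head e) := by
  simp [edgePoint, not_le.2 (G.len_pos e)]

theorem edgePoint_inner (G : GraphModel V E) (e : E) (t : Ioo (0 : ℝ) (G.len e)) :
    G.edgePoint e t = Point.inner e t := by
  have : 0 < (t : ℝ) ∧ (t : ℝ) < G.len e := t.2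
  simp [edgePoint, this]

/-- The sum of `a` over the edges with head `v`. -/
noncomputable def headSum [Fintype E] (G : GraphModel V E) (a : E → ℝ) (v : V) : ℝ :=
  ∑ e, if G.head e = v then a e else 0

/-- The sum of `a` over the edges with tail `v`. -/
noncomputable def tailSum [Fintype E] (G : GraphModel V E) (a : E → ℝ) (v : V) : ℝ :=
  ∑ e, if G.tail e = v then a e else 0

/-- The divisor `D` is the divisor of a rational function with values `F` at the vertices and slopes
`σ` into the heads of the edges. -/
def IsDivOf [Fintype E] (G : GraphModel V E) (D : G.Divisor) (F : V → ℝ) (σ : E → ℤ) : Prop :=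
  (∀ e, F (G.head e) - F (G.tail e) = G.edgeSum e id D + G.len e * σ e) ∧
    ∀ v, (D (Point.vertex v) : ℝ) = G.headSum (fun e => σ e) v -
      G.tailSum (fun e => σ e + G.edgeSum e (fun _ => 1) D) v

/-- Adding `ramp` to the restriction of `f` to an edge cancels every change of slope, so the sum is
affine; its slope and its increment give the two relations. -/
theorem LinEquiv.exists_isDivOf [Fintype E] {G : GraphModel V E} {D₁ D₂ : G.Divisor}
    (h : G.LinEquiv D₁ D₂) : ∃ F σ, G.IsDivOf (D₁ - D₂) F σ := by
  obtain ⟨f, ⟨-, hf⟩, hord⟩ := h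
  set D := D₁ - D₂
  have hedge : ∀ e, ∃ σ : ℤ, slopeFromLeft (G.onEdge f e) (G.len e) = σ ∧
      slopeFromRight (G.onEdge f e) 0 = -(σ + G.edgeSum e (fun _ => 1) D) ∧
      f (Point.vertex (G.head e)) - f (Point.vertex (G.tail e)) =
        G.edgeSum e id D + G.len e * σ := by
    intro e
    have hl := G.len_pos e
    obtain ⟨m₀, h0⟩ := (hf e).exists_hasRightSlope le_rfl hl
    obtain ⟨m₁, h1⟩ := (hf e).exists_hasLeftSlope hl le_rfl
    have h0' := h0.add (hasRightSlope_ramp (e := e) D 0)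
    have h1' := h1.add (hasLeftSlope_ramp (e := e) D (G.len e))
    obtain ⟨hm, hval⟩ := exists_affine_of_slopes hl h0' h1' (by
      intro t ht
      obtain ⟨a, ha⟩ := (hf e).exists_hasLeftSlope ht.1 ht.2.le
      obtain ⟨b, hb⟩ := (hf e).exists_hasRightSlope ht.1.le ht.2
      refine ⟨_, ha.add (hasLeftSlope_ramp (e := e) D t), ?_⟩
      have hb' := hb.add (hasRightSlope_ramp (e := e) D t)
      have ho := hord (Point.inner e ⟨t, ht⟩)
      simp only [ord, ha.slopeFromLeft, hb.slopeFromRight] at ho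
      have := edgeSum_le_sub_lt D ⟨t, ht⟩
      simp only at this
      rw [this] at hb'
      convert hb' using 1
      rw [ho]; ring)
    rw [edgeSum_le_zero, edgeSum_lt_len] at hm
    rw [edgeSum_le_zero, ramp_zero, ramp_len] at hval
    refine ⟨m₁, h1.slopeFromLeft, ?_, ?_⟩
    · rw [h0.slopeFromRight]; linarith
    · simp only [onEdge, edgePoint_zero, edgePoint_len] at hval
      have : (m₀ : ℝ) = m₁ + G.edgeSum e (fun _ => 1) D := by linarith
      rw [this] at hval
      linear_combination hval
  choose σ hσ1 hσ2 hσ3 using hedge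
  refine ⟨fun v => f (Point.vertex v), σ, hσ3, fun v => ?_⟩
  rw [hord]
  simp only [ord, hσ1, hσ2, headSum, tailSum]
  rw [add_comm, sub_eq_add_neg, ← Finset.sum_neg_distrib]
  congr 1
  refine Finset.sum_congr rfl fun e _ => ?_
  split_ifs <;> simp

/-- The rational function is rebuilt on each edge as an affine function minus `ramp`; the relation
on `F` is what makes it take the right value at the head. -/
theorem IsDivOf.linEquiv [Fintype E] {G : GraphModel V E} {D₁ D₂ : G.Divisor} {F : V → ℝ}
    {σ : E → ℤ} (h : G.IsDivOf (D₁ - D₂) F σ) : G.LinEquiv D₁ D₂ := by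
  set D := D₁ - D₂
  obtain ⟨hF, hD⟩ := h
  have hN : ∀ e, ∃ n : ℤ, G.edgeSum e (fun _ => 1) D = n :=
    fun e => exists_int_edgeSum (fun _ => ⟨1, by simp⟩) D
  choose N hN using hN
  let g : E → ℝ → ℝ := fun e u => F (G.tail e) + ((σ e + N e : ℤ) : ℝ) * u - G.ramp D e u
  let f : G.Point → ℝ := fun x => match x with
    | Point.vertex v => F v
    | Point.inner e t => g e t
  have hfg : ∀ e, ∀ u ∈ Icc 0 (G.len e), G.onEdge f e u = g e u := by
    intro e u hu
    rcases hu.1.eq_or_lt with rfl | h0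
    · simp [onEdge, edgePoint_zero, f, g, ramp_zero]
    rcases hu.2.eq_or_lt with rfl | h1
    · simp only [onEdge, edgePoint_len, f, g, ramp_len, hN]
      push_cast
      linear_combination hF e
    · rw [onEdge, edgePoint_inner G e ⟨u, h0, h1⟩]
  have hgR : ∀ e t, HasRightSlope (g e)
      ((σ e + N e : ℤ) - G.edgeSum e (fun s => if s ≤ t then 1 else 0) D) t := by
    intro e t
    filter_upwards [hasRightSlope_ramp (e := e) D t] with u hu
    simp only [g, hu]; ring
  have hgL : ∀ e t, HasLeftSlope (g e)
      ((σ e + N e : ℤ) - G.edgeSum e (fun s => if s < t then 1 else 0) D) t := by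
    intro e t
    filter_upwards [hasLeftSlope_ramp (e := e) D t] with u hu
    simp only [g, hu]; ring
  have hR : ∀ e, ∀ t ∈ Ico 0 (G.len e), slopeFromRight (G.onEdge f e) t =
      -((σ e + N e : ℤ) - G.edgeSum e (fun s => if s ≤ t then 1 else 0) D) := fun e t ht =>
    ((hgR e t).congr ht.2 fun u hu => hfg e u ⟨ht.1.trans hu.1, hu.2⟩).slopeFromRight
  have hL : ∀ e, ∀ t ∈ Ioc 0 (G.len e), slopeFromLeft (G.onEdge f e) t =
      ((σ e + N e : ℤ) - G.edgeSum e (fun s => if s < t then 1 else 0) D) := fun e t ht =>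
    ((hgL e t).congr ht.1 fun u hu => hfg e u ⟨hu.1, hu.2.trans ht.2⟩).slopeFromLeft
  refine ⟨f, ⟨?_, fun e => ?_⟩, fun x => ?_⟩
  · refine continuous_iSup_dom.2 fun e => continuous_coinduced_dom.2 ?_
    have : Continuous fun t : Icc (0 : ℝ) (G.len e) => g e t := by
      simp only [g, ramp, edgeSum]
      refine Continuous.sub (by fun_prop) (continuous_finsetSum _ fun x _ => ?_)
      refine continuous_const.mul ?_
      cases x with
      | vertex v => exact continuous_const
      | inner e' s =>
        by_cases he : e' = e
        · simp only [edgeCoeff, he, if_true]; fun_prop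
        · simp only [edgeCoeff, he, if_false]; exact continuous_const
    exact this.congr fun t => (hfg e t t.2).symm
  · obtain ⟨S, hS, h⟩ := isPiecewiseAffine_sub_ramp (e := e) D (F (G.tail e)) (σ e + N e)
    refine ⟨S, hS, fun a b ha hb hab => ?_⟩
    obtain ⟨m, c, hmc⟩ := h a b ha hb hab
    exact ⟨m, c, fun t ht => by
      rw [hfg e t ⟨ha.trans ht.1, ht.2.trans hb⟩]; exact hmc t ht⟩
  · cases x with
    | vertex v =>
      have h1 := fun e => hR e 0 ⟨le_rfl, G.len_pos e⟩
      have h2 := fun e => hL e (G.len e) ⟨G.len_pos e, le_rfl⟩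
      rw [hD]
      simp only [ord, h1, h2, edgeSum_le_zero, edgeSum_lt_len, headSum, tailSum, hN]
      rw [add_comm, sub_eq_add_neg, ← Finset.sum_neg_distrib]
      congr 1 <;>
      · refine Finset.sum_congr rfl fun e _ => ?_
        split_ifs <;> simp
    | inner e t =>
      simp only [ord]
      rw [hR e t ⟨t.2.1.le, t.2.2⟩, hL e t ⟨t.2.1, t.2.2.le⟩, edgeSum_le_sub_lt]
      ring

theorem linEquiv_iff [Fintype E] {G : GraphModel V E} {D₁ D₂ : G.Divisor} :
    G.LinEquiv D₁ D₂ ↔ ∃ F σ, G.IsDivOf (D₁ - D₂) F σ :=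
  ⟨fun h => h.exists_isDivOf, fun ⟨_, _, h⟩ => h.linEquiv⟩

/-! ### The piecewise affine model of the parabola -/

section Profile

/-- The convex function on `ℝ` that agrees with `x ↦ x² / 2` at the integers and is affine between
consecutive integers. -/
noncomputable def profile (x : ℝ) : ℝ := (x ^ 2 + Int.fract x * (1 - Int.fract x)) / 2

theorem continuous_profile : Continuous profile := by
  have : Continuous ((fun r : ℝ => r * (1 - r)) ∘ Int.fract) :=
    ContinuousOn.comp_fract'' (by fun_prop) (by simp)
  exact ((continuous_id.pow 2).add this).div_const 2

theorem sq_le_profile (x : ℝ) : x ^ 2 / 2 ≤ profile x := by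
  have := mul_nonneg (Int.fract_nonneg x) (sub_nonneg.2 (Int.fract_lt_one x).le)
  unfold profile; linarith

/-- The line is the chord over `[n, n + 1]`. With `⌊x⌋ = n + k` and `r = fract x` the gap is `(k (k
- 1) + 2 k r) / 2`, nonnegative because `k` is an integer and `0 ≤ r < 1`. -/
theorem le_profile (n : ℤ) (x : ℝ) : (n + 1 / 2) * x - n * (n + 1) / 2 ≤ profile x := by
  have hx := Int.floor_add_fract x
  have h0 := Int.fract_nonneg x
  have h1 := Int.fract_lt_one x
  unfold profile
  set r := Int.fract x
  obtain ⟨k, hk⟩ : ∃ k : ℤ, ⌊x⌋ = n + k := ⟨⌊x⌋ - n, by ring⟩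
  rw [hk] at hx
  push_cast at hx
  have key : 0 ≤ (k : ℝ) * (k - 1) + 2 * k * r := by
    rcases lt_trichotomy k 0 with h | h | h
    · have : (k : ℝ) ≤ -1 := by exact_mod_cast Int.le_sub_one_of_lt h
      nlinarith
    · simp [h]
    · have : (1 : ℝ) ≤ k := by exact_mod_cast h
      have : 0 ≤ (k : ℝ) * (k - 1) := by nlinarith
      have : 0 ≤ 2 * (k : ℝ) * r := by positivity
      linarith
  rw [← hx]
  linarith [show ((n + k + r : ℝ) ^ 2 + r * (1 - r)) / 2 - ((n + 1 / 2) * (n + k + r) -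
    n * (n + 1) / 2) = ((k : ℝ) * (k - 1) + 2 * k * r) / 2 by ring]

/-- Both ends are included so that at an integer either adjacent chord can be used: `n = ⌊x⌋` yields
the right derivative and `n = ⌈x⌉ - 1` the left one. -/
theorem profile_eq {n : ℤ} {x : ℝ} (h0 : n ≤ x) (h1 : x ≤ n + 1) :
    profile x = (n + 1 / 2) * x - n * (n + 1) / 2 := by
  rcases h1.eq_or_lt with rfl | h1
  · have : Int.fract ((n : ℝ) + 1) = 0 := by
      rw [Int.fract_add_one, Int.fract_intCast]
    rw [profile, this]; ring
  · have : ⌊x⌋ = n := Int.floor_eq_iff.2 ⟨h0, h1⟩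
    rw [profile, Int.fract, this]; ring

/-- Convexity, with the right derivative `⌊x⌋ + 1/2` and the left derivative `⌈x⌉ - 1/2`; they
differ exactly at integers. -/
theorem profile_add_le (x u : ℝ) :
    profile x + ((⌊x⌋ + 1 / 2) * max u 0 - (⌈x⌉ - 1 / 2) * max (-u) 0) ≤ profile (x + u) := by
  rcases le_total 0 u with h | h
  · have h1 := le_profile ⌊x⌋ (x + u)
    rw [profile_eq (Int.floor_le x) (Int.lt_floor_add_one x).le, max_eq_left h,
      max_eq_right (by linarith)]
    linarith
  · have h1 := le_profile (⌈x⌉ - 1) (x + u)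
    have h2 := Int.ceil_lt_add_one x
    rw [profile_eq (n := ⌈x⌉ - 1) (by push_cast; linarith) (by push_cast; linarith [Int.le_ceil x]),
      max_eq_right h, max_eq_left (by linarith)]
    push_cast at h1 ⊢
    linarith

theorem profile_subgradient (x y : ℝ) : profile x + (⌊x⌋ + 1 / 2) * (y - x) ≤ profile y := by
  have h1 := le_profile ⌊x⌋ y
  rw [profile_eq (Int.floor_le x) (Int.lt_floor_add_one x).le]
  linarith

theorem profile_right (x : ℝ) :
    ∀ᶠ u in 𝓝[>] (0 : ℝ), profile (x + u) = profile x + (⌊x⌋ + 1 / 2) * u := by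
  have h : (0 : ℝ) < ⌊x⌋ + 1 - x := by linarith [Int.lt_floor_add_one x]
  filter_upwards [Ioo_mem_nhdsGT h] with u hu
  have hx := Int.floor_le x
  rw [profile_eq hx (by linarith), profile_eq (n := ⌊x⌋) (by linarith [hu.1]) (by linarith [hu.2])]
  ring

theorem profile_left (x : ℝ) :
    ∀ᶠ u in 𝓝[>] (0 : ℝ), profile (x - u) = profile x - (⌈x⌉ - 1 / 2) * u := by
  have h : (0 : ℝ) < x - (⌈x⌉ - 1) := by linarith [Int.ceil_lt_add_one x]
  filter_upwards [Ioo_mem_nhdsGT h] with u hu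
  have hx := Int.le_ceil x
  rw [profile_eq (n := ⌈x⌉ - 1) (x := x) (by push_cast; linarith) (by push_cast; linarith),
    profile_eq (n := ⌈x⌉ - 1) (x := x - u) (by push_cast; linarith [hu.2])
      (by push_cast; linarith [hu.1])]
  push_cast
  ring

end Profile

/-! ### From indicator functions to all functions -/

section LayerCake

open MeasureTheory

/-- An inequality between Lovász extensions follows from its restriction to indicator functions. -/
theorem sum_mul_le_of_threshold {V E : Type*} [Fintype V] [Fintype E] (h t : E → V) (p : V → ℝ)
    (a b : E → ℝ) (hp : ∑ v, p v = 0)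
    (H : ∀ I : Finset V, ∑ v ∈ I, p v ≤ ∑ e, ((if h e ∈ I ∧ t e ∉ I then a e else 0) -
      (if t e ∈ I ∧ h e ∉ I then b e else 0))) (u : V → ℝ) :
    ∑ v, p v * u v ≤ ∑ e, (a e * max (u (h e) - u (t e)) 0 - b e * max (u (t e) - u (h e)) 0) := by
  -- Each `max (y - x) 0` is the length of `[x, y)`, and since `p` has sum `0`, `u v` may be
  -- replaced by `u v - m`, the length of `[m, u v)`. At a level `s ≥ m` the integrands are the two
  -- sides of `H` for `{v | s < u v}`; below `m` both vanish.
  obtain ⟨m, hm⟩ := (Set.finite_range u).bddBelow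
  have hm : ∀ v, m ≤ u v := fun v => hm ⟨v, rfl⟩
  have hint : ∀ x y : ℝ, Integrable ((Ico x y).indicator (1 : ℝ → ℝ)) := fun x y =>
    (integrable_indicator_iff measurableSet_Ico).2 (integrableOn_const (by simp))
  have hval : ∀ x y : ℝ, ∫ s, (Ico x y).indicator (1 : ℝ → ℝ) s = max (y - x) 0 := fun x y => by
    rw [integral_indicator_one measurableSet_Ico, Real.volume_real_Ico]
  have hL : ∑ v, p v * u v = ∫ s, ∑ v, p v * (Ico m (u v)).indicator (1 : ℝ → ℝ) s := by
    rw [integral_finsetSum _ fun v _ => (hint _ _).const_mul _]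
    simp_rw [integral_const_mul, hval]
    have : ∑ v, p v * u v = ∑ v, p v * u v - (∑ v, p v) * m := by rw [hp]; ring
    rw [this, Finset.sum_mul, ← Finset.sum_sub_distrib]
    refine Finset.sum_congr rfl fun v _ => ?_
    rw [max_eq_left (by linarith [hm v])]; ring
  have hR : ∑ e, (a e * max (u (h e) - u (t e)) 0 - b e * max (u (t e) - u (h e)) 0) =
      ∫ s, ∑ e, (a e * (Ico (u (t e)) (u (h e))).indicator (1 : ℝ → ℝ) s -
        b e * (Ico (u (h e)) (u (t e))).indicator (1 : ℝ → ℝ) s) := by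
    have hi : ∀ e, Integrable fun s =>
        a e * (Ico (u (t e)) (u (h e))).indicator (1 : ℝ → ℝ) s -
          b e * (Ico (u (h e)) (u (t e))).indicator (1 : ℝ → ℝ) s := fun e =>
      ((hint _ _).const_mul _).sub ((hint _ _).const_mul _)
    rw [integral_finsetSum _ fun e _ => hi e]
    refine Finset.sum_congr rfl fun e _ => ?_
    rw [integral_sub ((hint _ _).const_mul _) ((hint _ _).const_mul _), integral_const_mul,
      integral_const_mul, hval, hval]
  rw [hL, hR]
  refine integral_mono (integrable_finsetSum _ fun v _ => (hint _ _).const_mul _)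
    (integrable_finsetSum _ fun e _ => ((hint _ _).const_mul _).sub ((hint _ _).const_mul _))
    fun s => ?_
  rcases lt_or_ge s m with hs | hs
  · have h1 : ∀ x, s ∉ Ico m x := fun x hx => absurd hx.1 (not_le.2 hs)
    have h2 : ∀ v x, s ∉ Ico (u v) x := fun v x hx => absurd ((hm v).trans hx.1) (not_le.2 hs)
    simp [Set.indicator, h1, h2]
  · refine (Eq.le ?_).trans ((H (Finset.univ.filter fun v => s < u v)).trans (Eq.ge ?_))
    · rw [Finset.sum_filter]
      refine Finset.sum_congr rfl fun v _ => ?_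
      by_cases hv : s < u v <;> simp [Set.indicator, hs, hv]
    · refine Finset.sum_congr rfl fun e _ => ?_
      simp only [Set.indicator, Set.mem_Ico, Finset.mem_filter, Finset.mem_univ, true_and, not_lt,
        Pi.one_apply, mul_ite, mul_one, mul_zero, and_comm]

end LayerCake

/-! ### Admissible divisors and functions on the vertices -/

section Potential

variable (G : GraphModel V E) (D₀ : G.Divisor)

/-- The slope along `e` of a function with values `f` at the vertices, corrected by the moment
of `D₀` on `e`. -/
noncomputable def slope (f : V → ℝ) (e : E) : ℝ :=
  (f (G.head e) - f (G.tail e) + G.edgeSum e id D₀) / G.len e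

theorem len_mul_slope (f : V → ℝ) (e : E) :
    G.len e * G.slope D₀ f e = f (G.head e) - f (G.tail e) + G.edgeSum e id D₀ :=
  mul_div_cancel₀ _ (G.len_pos e).ne'

theorem slope_add (f g : V → ℝ) (e : E) :
    G.slope D₀ (fun v => f v + g v) e =
      G.slope D₀ f e + (g (G.head e) - g (G.tail e)) / G.len e := by
  rw [slope, slope, ← add_div]; ring

/-- The vertex weights of `D₀`, the chips on edges being moved to the tails. -/
noncomputable def base [Fintype E] (v : V) : ℝ :=
  D₀ (Point.vertex v) + G.tailSum (fun e => G.edgeSum e (fun _ => 1) D₀) v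

/-- `D` is the admissible divisor obtained from `D₀` and the function `f` on the vertices. -/
structure HasPotential [Fintype E] (D : G.Divisor) (f : V → ℝ) : Prop where
  vertex : ∀ v, (D (Point.vertex v) : ℝ) = G.base D₀ v +
    G.headSum (fun e => ⌊G.slope D₀ f e⌋) v - G.tailSum (fun e => ⌈G.slope D₀ f e⌉) v
  edgeSum_one : ∀ e, G.edgeSum e (fun _ => 1) D = ⌈G.slope D₀ f e⌉ - ⌊G.slope D₀ f e⌋

variable {G D₀}

theorem slope_add_const (f : V → ℝ) (k : ℝ) (e : E) :
    G.slope D₀ (fun v => f v + k) e = G.slope D₀ f e := by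
  simp [slope]

theorem tailSum_sub [Fintype E] (a b : E → ℝ) (v : V) :
    G.tailSum (fun e => a e - b e) v = G.tailSum a v - G.tailSum b v := by
  unfold tailSum
  rw [← Finset.sum_sub_distrib]
  exact Finset.sum_congr rfl fun e _ => by split_ifs <;> simp

theorem tailSum_int [Fintype E] {a : E → ℝ} (h : ∀ e, ∃ n : ℤ, a e = n) (v : V) :
    ∃ n : ℤ, G.tailSum a v = n := by
  choose n hn using h
  exact ⟨∑ e, if G.tail e = v then n e else 0, by simp [tailSum, hn]⟩

theorem headSum_int [Fintype E] {a : E → ℝ} (h : ∀ e, ∃ n : ℤ, a e = n) (v : V) :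
    ∃ n : ℤ, G.headSum a v = n := by
  choose n hn using h
  exact ⟨∑ e, if G.head e = v then n e else 0, by simp [headSum, hn]⟩

/-- Here `r` is the relative position of the only chip on `e`, or `0` if there is none, so that
`⌈r⌉` counts the chips. -/
theorem IsAdmissible.exists_fract {D : G.Divisor} (hD : G.IsAdmissible D) (e : E) :
    ∃ r : ℝ, 0 ≤ r ∧ r < 1 ∧ G.edgeSum e id D = G.len e * r ∧
      G.edgeSum e (fun _ => 1) D = ⌈r⌉ := by
  by_cases h : ∀ t, D (Point.inner e t) = 0
  · exact ⟨0, le_rfl, one_pos, by simp [edgeSum_eq_zero _ h], by simp [edgeSum_eq_zero _ h]⟩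
  · push Not at h
    obtain ⟨t, ht⟩ := h
    have h1 := ((hD e).1 t).resolve_left ht
    have h0 : ∀ s, s ≠ t → D (Point.inner e s) = 0 := fun s hs => by
      by_contra hne
      exact hs ((hD e).2 s t hne ht)
    have hl := G.len_pos e
    have hr0 : 0 < (t : ℝ) / G.len e := div_pos t.2.1 hl
    have hr1 : (t : ℝ) / G.len e < 1 := (div_lt_one hl).2 t.2.2
    refine ⟨t / G.len e, hr0.le, hr1, ?_, ?_⟩
    · rw [edgeSum_eq_of_forall_ne _ t h0, h1]; field_simp; simp
    · have : ⌈(t : ℝ) / G.len e⌉ = 1 := Int.ceil_eq_iff.2 ⟨by simpa using hr0, by simpa using hr1.le⟩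
      rw [edgeSum_eq_of_forall_ne _ t h0, h1, this]; simp

/-- The corrected slope is `r e + σ e` with `0 ≤ r e < 1`, so its floor is `σ e` and its ceiling
adds the number of chips on `e`. -/
theorem LinEquiv.exists_hasPotential [Fintype E] {D : G.Divisor} (h : G.LinEquiv D D₀)
    (hD : G.IsAdmissible D) : ∃ f, G.HasPotential D₀ D f := by
  obtain ⟨F, σ, hF, hv⟩ := h.exists_isDivOf
  choose r hr0 hr1 hM hN using hD.exists_fract
  have hx : ∀ e, G.slope D₀ F e = r e + σ e := fun e => by
    have := hF e
    rw [edgeSum_sub, hM] at this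
    rw [slope, div_eq_iff (G.len_pos e).ne']
    linear_combination this
  have hfl : ∀ e, ⌊G.slope D₀ F e⌋ = σ e := fun e => by
    rw [hx, Int.floor_add_intCast, Int.floor_eq_zero_iff.2 ⟨hr0 e, hr1 e⟩, zero_add]
  have hce : ∀ e, ⌈G.slope D₀ F e⌉ = ⌈r e⌉ + σ e := fun e => by
    rw [hx, Int.ceil_add_intCast]
  refine ⟨F, fun v => ?_, fun e => ?_⟩
  · have := hv v
    rw [Finsupp.sub_apply] at this
    push_cast at this
    have h2 : G.tailSum (fun e => σ e + G.edgeSum e (fun _ => 1) (D - D₀)) v =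
        G.tailSum (fun e => (⌈G.slope D₀ F e⌉ : ℝ)) v -
          G.tailSum (fun e => G.edgeSum e (fun _ => 1) D₀) v := by
      rw [← tailSum_sub]
      congr 1
      funext e
      rw [edgeSum_sub, hN, hce]; push_cast; ring
    rw [h2] at this
    simp only [base, hfl]
    linear_combination this
  · rw [hN, hce, hfl]; push_cast; ring

theorem exists_admissible_hasPotential [Fintype V] [Fintype E] (D₀ : G.Divisor) (f : V → ℝ) :
    ∃ D, G.LinEquiv D D₀ ∧ G.IsAdmissible D ∧ G.HasPotential D₀ D f ∧
      ∀ e t, D (Point.inner e t) ≠ 0 → (t : ℝ) = G.len e * Int.fract (G.slope D₀ f e) := by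
  have hint : ∀ v, ∃ k : ℤ, G.base D₀ v +
      G.headSum (fun e => ⌊G.slope D₀ f e⌋) v - G.tailSum (fun e => ⌈G.slope D₀ f e⌉) v = k := by
    intro v
    obtain ⟨a, ha⟩ := tailSum_int (G := G) (a := fun e => G.edgeSum e (fun _ => 1) D₀)
      (fun e => exists_int_edgeSum (fun _ => ⟨1, by simp⟩) D₀) v
    obtain ⟨b, hb⟩ := headSum_int (G := G) (a := fun e => ⌊G.slope D₀ f e⌋) (fun e => ⟨_, rfl⟩) v
    obtain ⟨c, hc⟩ := tailSum_int (G := G) (a := fun e => ⌈G.slope D₀ f e⌉) (fun e => ⟨_, rfl⟩) v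
    exact ⟨D₀ (Point.vertex v) + a + b - c, by rw [base, ha, hb, hc]; push_cast; ring⟩
  choose k hk using hint
  -- For an integral slope the prescribed coordinate is `0`, which is not in the open edge, so no
  -- chip is placed.
  let w : G.Point → ℤ := fun x => match x with
    | Point.vertex v => k v
    | Point.inner e t => if (t : ℝ) = G.len e * Int.fract (G.slope D₀ f e) then 1 else 0
  have hw : (Function.support w).Finite := by
    refine ((Set.finite_range (fun v : V => (Point.vertex v : G.Point))).union
      (Set.finite_range fun e => G.edgePoint e (G.len e * Int.fract (G.slope D₀ f e)))).subset ?_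
    intro x hx
    cases x with
    | vertex v => exact Or.inl ⟨v, rfl⟩
    | inner e t =>
      refine Or.inr ⟨e, ?_⟩
      have : (t : ℝ) = G.len e * Int.fract (G.slope D₀ f e) := by
        by_contra h
        exact hx (if_neg h)
      simp only [← this, edgePoint_inner]
  let D : G.Divisor := Finsupp.ofSupportFinite w hw
  have hDv : ∀ v, D (Point.vertex v) = k v := fun v => rfl
  have hDe : ∀ e t, D (Point.inner e t) =
    if (t : ℝ) = G.len e * Int.fract (G.slope D₀ f e) then 1 else 0 := fun e t => rfl
  have hne : ∀ e t, D (Point.inner e t) ≠ 0 →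
      (t : ℝ) = G.len e * Int.fract (G.slope D₀ f e) := fun e t h => by
    by_contra h'
    exact h (by rw [hDe, if_neg h'])
  have hadm : G.IsAdmissible D := fun e =>
    ⟨fun t => by rw [hDe]; split_ifs <;> simp, fun s t hs ht =>
      Subtype.ext ((hne e s hs).trans (hne e t ht).symm)⟩
  have hedge : ∀ e, G.edgeSum e id D = G.len e * Int.fract (G.slope D₀ f e) ∧
      G.edgeSum e (fun _ => 1) D = ⌈G.slope D₀ f e⌉ - ⌊G.slope D₀ f e⌋ := by
    intro e
    have hl := G.len_pos e
    rcases (Int.fract_nonneg (G.slope D₀ f e)).eq_or_lt with h0 | h0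
    · have hz : ∀ t, D (Point.inner e t) = 0 := fun t => by
        rw [hDe, if_neg]
        rw [← h0, mul_zero]
        exact t.2.1.ne'
      rw [edgeSum_eq_zero _ hz, edgeSum_eq_zero _ hz, ← h0]
      refine ⟨by simp, ?_⟩
      have h2 : G.slope D₀ f e = ⌊G.slope D₀ f e⌋ := by
        have := Int.floor_add_fract (G.slope D₀ f e)
        linarith
      have h3 : ⌈G.slope D₀ f e⌉ = ⌊G.slope D₀ f e⌋ := by
        conv_lhs => rw [h2, Int.ceil_intCast]
      rw [h3, sub_self]
    · have h1 := Int.fract_lt_one (G.slope D₀ f e)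
      let t : Ioo (0 : ℝ) (G.len e) := ⟨G.len e * Int.fract (G.slope D₀ f e), by positivity,
        by nlinarith⟩
      have hz : ∀ s, s ≠ t → D (Point.inner e s) = 0 := fun s hs => by
        by_contra h
        exact hs (Subtype.ext (hne e s h))
      have ht : D (Point.inner e t) = 1 := by rw [hDe, if_pos rfl]
      rw [edgeSum_eq_of_forall_ne _ t hz, edgeSum_eq_of_forall_ne _ t hz, ht]
      refine ⟨by simp [t], ?_⟩
      have h3 : ⌈G.slope D₀ f e⌉ = ⌊G.slope D₀ f e⌋ + 1 := by
        have := Int.floor_add_fract (G.slope D₀ f e)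
        exact Int.ceil_eq_iff.2 ⟨by push_cast; linarith, by push_cast; linarith⟩
      rw [h3]; push_cast; ring
  refine ⟨D, linEquiv_iff.2 ⟨f, fun e => ⌊G.slope D₀ f e⌋, fun e => ?_, fun v => ?_⟩, hadm,
    ⟨fun v => by rw [hDv, hk], fun e => (hedge e).2⟩, hne⟩
  · rw [edgeSum_sub, (hedge e).1]
    have := G.len_mul_slope D₀ f e
    rw [← Int.floor_add_fract (G.slope D₀ f e)] at this
    linear_combination -this
  · rw [Finsupp.sub_apply, hDv]
    push_cast
    rw [← hk, base]
    have h2 : G.tailSum (fun e => ⌊G.slope D₀ f e⌋ + G.edgeSum e (fun _ => 1) (D - D₀)) v =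
        G.tailSum (fun e => (⌈G.slope D₀ f e⌉ : ℝ)) v -
          G.tailSum (fun e => G.edgeSum e (fun _ => 1) D₀) v := by
      rw [← tailSum_sub]
      congr 1
      funext e
      rw [edgeSum_sub, (hedge e).2]; ring
    rw [h2]; ring

end Potential

/-! ### Degrees and changes of base divisor -/

section Degree

variable {G : GraphModel V E}

theorem degOn_eq [Fintype E] (D : G.Divisor) (I : Finset V) :
    (G.degOn D I : ℝ) = ∑ v ∈ I, (D (Point.vertex v) : ℝ) +
      ∑ e, if G.tail e ∈ I ∧ G.head e ∈ I then G.edgeSum e (fun _ => 1) D else 0 := by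
  have hv : ∀ v, (D (Point.vertex v) : ℝ) =
      ∑ x ∈ D.support, (D x : ℝ) * if x = Point.vertex v then 1 else 0 := by
    intro v
    simp only [mul_ite, mul_one, mul_zero, Finset.sum_ite_eq', Finsupp.mem_support_iff]
    by_cases h : D (Point.vertex v) = 0 <;> simp [h]
  have he : ∀ e, (if G.tail e ∈ I ∧ G.head e ∈ I then G.edgeSum e (fun _ => 1) D else 0) =
      ∑ x ∈ D.support, (D x : ℝ) *
        if G.tail e ∈ I ∧ G.head e ∈ I then G.edgeCoeff e (fun _ => 1) x else 0 := by
    intro e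
    split_ifs <;> simp [edgeSum]
  simp_rw [he]
  rw [Finset.sum_congr rfl fun v _ => hv v, Finset.sum_comm, Finset.sum_comm (s := Finset.univ),
    ← Finset.sum_add_distrib, degOn, Finsupp.sum]
  push_cast
  refine Finset.sum_congr rfl fun x _ => ?_
  rw [← Finset.mul_sum, ← Finset.mul_sum, ← mul_add]
  cases x with
  | vertex v => by_cases h : v ∈ I <;> simp [region, edgeCoeff, h]
  | inner e t =>
    rw [Finset.sum_eq_zero (s := I) (fun v _ => by simp), zero_add,
      Finset.sum_eq_single e (fun e' _ hne => by simp [edgeCoeff, hne.symm]) (by simp)]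
    by_cases h : G.tail e ∈ I ∧ G.head e ∈ I <;> simp [region, edgeCoeff, h]

theorem degOn_univ [Fintype V] (D : G.Divisor) : G.degOn D Finset.univ = G.deg D := by
  unfold degOn deg
  refine Finsupp.sum_congr fun x _ => if_pos ?_
  cases x <;> simp [region]

theorem sum_headSum [Fintype E] (a : E → ℝ) (I : Finset V) :
    ∑ v ∈ I, G.headSum a v = ∑ e, if G.head e ∈ I then a e else 0 := by
  unfold headSum
  rw [Finset.sum_comm]
  simp

theorem sum_tailSum [Fintype E] (a : E → ℝ) (I : Finset V) :
    ∑ v ∈ I, G.tailSum a v = ∑ e, if G.tail e ∈ I then a e else 0 := by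
  unfold tailSum
  rw [Finset.sum_comm]
  simp

/-- An edge with interior degree `N` contributes `σ` at its head, `-(σ + N)` at its tail and `N`
inside. -/
theorem IsDivOf.deg_eq_zero [Fintype V] [Fintype E] {D : G.Divisor} {F : V → ℝ} {σ : E → ℤ}
    (h : G.IsDivOf D F σ) : G.deg D = 0 := by
  have : (G.deg D : ℝ) = 0 := by
    rw [← degOn_univ, degOn_eq, Finset.sum_congr rfl fun v _ => h.2 v, Finset.sum_sub_distrib,
      sum_headSum, sum_tailSum, ← Finset.sum_sub_distrib, ← Finset.sum_add_distrib]
    exact Finset.sum_eq_zero fun e _ => by simp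
  exact_mod_cast this

theorem deg_sub (D D' : G.Divisor) : G.deg (D - D') = G.deg D - G.deg D' :=
  Finsupp.sum_sub_index fun _ _ _ => rfl

theorem LinEquiv.deg_eq [Fintype V] [Fintype E] {D D' : G.Divisor} (h : G.LinEquiv D D') :
    G.deg D = G.deg D' := by
  obtain ⟨F, σ, h⟩ := h.exists_isDivOf
  have := h.deg_eq_zero
  rw [deg_sub] at this
  linarith

theorem LinEquiv.sub_right [Fintype E] {D₁ D₂ D₃ : G.Divisor} (h₁ : G.LinEquiv D₁ D₃)
    (h₂ : G.LinEquiv D₂ D₃) : G.LinEquiv D₁ D₂ := by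
  obtain ⟨F, σ, hF, hv⟩ := h₁.exists_isDivOf
  obtain ⟨F', σ', hF', hv'⟩ := h₂.exists_isDivOf
  refine linEquiv_iff.2 ⟨fun v => F v - F' v, fun e => σ e - σ' e, fun e => ?_, fun v => ?_⟩
  · have h1 := hF e
    have h2 := hF' e
    rw [edgeSum_sub] at h1 h2 ⊢
    push_cast
    linear_combination h1 - h2
  · have h1 := hv v
    have h2 := hv' v
    rw [Finsupp.sub_apply] at h1 h2 ⊢
    push_cast at h1 h2 ⊢
    have : (D₁ (Point.vertex v) : ℝ) - D₂ (Point.vertex v) =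
        (D₁ (Point.vertex v) - D₃ (Point.vertex v)) -
          (D₂ (Point.vertex v) - D₃ (Point.vertex v)) := by ring
    rw [this, h1, h2]
    unfold headSum tailSum
    simp only [← Finset.sum_sub_distrib]
    refine Finset.sum_congr rfl fun e _ => ?_
    simp only [edgeSum_sub]
    split_ifs <;> ring

theorem LinEquiv.refl [Fintype E] (D : G.Divisor) : G.LinEquiv D D := by
  refine linEquiv_iff.2 ⟨0, 0, fun e => ?_, fun v => ?_⟩ <;>
    simp [edgeSum, headSum, tailSum]

/-- This lets a `Λ`-rational member of the class serve as base divisor. -/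
theorem IsLinearClass.eq_of_mem [Fintype V] [Fintype E] {d : ℤ} {L : Set G.Divisor}
    (hL : G.IsLinearClass d L) {D : G.Divisor} (hD : D ∈ L) :
    G.deg D = d ∧ L = {D' | G.LinEquiv D' D} := by
  obtain ⟨D₀, h0, rfl⟩ := hL
  refine ⟨(LinEquiv.deg_eq hD).trans h0, ?_⟩
  have hD0 : G.LinEquiv D₀ D := (LinEquiv.refl D₀).sub_right hD
  ext D'
  exact ⟨fun h => LinEquiv.sub_right h hD, fun h => LinEquiv.sub_right h hD0⟩

end Degree

/-! ### Semistability polytopes as subdifferentials -/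

section Cells

variable [Fintype E] (G : GraphModel V E)

/-- The right-hand sides of the inequalities cutting out a tile. -/
noncomputable def gain (a b : E → ℤ) (I : Finset V) : ℝ :=
  ∑ e, ((if G.head e ∈ I ∧ G.tail e ∉ I then (a e + 1 / 2 : ℝ) else 0) -
    (if G.tail e ∈ I ∧ G.head e ∉ I then (b e - 1 / 2 : ℝ) else 0))

/-- The polytope cut out by the inequalities with right-hand sides `gain`, with origin `c`. -/
def cutCell [Fintype V] (c : V → ℝ) (a b : E → ℤ) : Set (V → ℝ) :=
  {q | ∑ v, (q v - c v) = 0 ∧ ∀ I : Finset V, ∑ v ∈ I, (q v - c v) ≤ G.gain a b I}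

variable (D₀ : G.Divisor)

/-- A convex energy of functions on the vertices. -/
noncomputable def energy (f : V → ℝ) : ℝ := ∑ e, G.len e * profile (G.slope D₀ f e)

/-- The pairing of `q`, with origin `base`, and `f`. -/
noncomputable def pairing [Fintype V] (q f : V → ℝ) : ℝ := ∑ v, (q v - G.base D₀ v) * f v

/-- The set of subgradients of the energy at `f`. -/
def cell [Fintype V] (f : V → ℝ) : Set (V → ℝ) :=
  {q | ∀ g, G.energy D₀ f - G.pairing D₀ q f ≤ G.energy D₀ g - G.pairing D₀ q g}

variable {G D₀}

theorem gain_univ [Fintype V] (a b : E → ℤ) : G.gain a b Finset.univ = 0 := by simp [gain]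

theorem sum_base [Fintype V] : ∑ v, G.base D₀ v = G.deg D₀ := by
  rw [← degOn_univ, degOn_eq]
  simp only [base, Finset.sum_add_distrib, sum_tailSum]
  simp

theorem cut_eq (I : Finset V) : (G.cut I : ℝ) =
    ∑ e, ((if G.head e ∈ I ∧ G.tail e ∉ I then (1 : ℝ) else 0) +
      (if G.tail e ∈ I ∧ G.head e ∉ I then 1 else 0)) := by
  rw [cut, Finset.card_filter]
  push_cast
  refine Finset.sum_congr rfl fun e _ => ?_
  by_cases h : G.head e ∈ I <;> by_cases t : G.tail e ∈ I <;> simp [h, t]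

theorem HasPotential.degOn_eq {D : G.Divisor} {f : V → ℝ} (h : G.HasPotential D₀ D f)
    (I : Finset V) : (G.degOn D I : ℝ) = ∑ v ∈ I, G.base D₀ v +
      ∑ e, ((if G.head e ∈ I ∧ G.tail e ∉ I then (⌊G.slope D₀ f e⌋ : ℝ) else 0) -
        (if G.tail e ∈ I ∧ G.head e ∉ I then (⌈G.slope D₀ f e⌉ : ℝ) else 0)) := by
  rw [GraphModel.degOn_eq, Finset.sum_congr rfl fun v _ => h.vertex v, Finset.sum_sub_distrib,
    Finset.sum_add_distrib, sum_headSum, sum_tailSum, add_sub_assoc, ← Finset.sum_sub_distrib,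
    add_assoc, ← Finset.sum_add_distrib]
  congr 1
  refine Finset.sum_congr rfl fun e _ => ?_
  rw [h.edgeSum_one]
  by_cases h : G.head e ∈ I <;> by_cases t : G.tail e ∈ I <;> simp [h, t]

/-- The upper bound on the sum of `q` over `I` is the `gain` inequality. The lower bound follows
from the upper one for `Iᶜ`: chips inside cut edges count for neither side, and their number,
ceiling minus floor, is nonnegative. -/
theorem HasPotential.semistabilityPolytope_eq [Fintype V] {D : G.Divisor} {f : V → ℝ}
    (h : G.HasPotential D₀ D f) : G.semistabilityPolytope D =
      G.cutCell (G.base D₀) (fun e => ⌊G.slope D₀ f e⌋) (fun e => ⌈G.slope D₀ f e⌉) := by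
  set a : E → ℤ := fun e => ⌊G.slope D₀ f e⌋
  set b : E → ℤ := fun e => ⌈G.slope D₀ f e⌉
  have hgain : ∀ I, G.gain a b I =
      (G.degOn D I : ℝ) - ∑ v ∈ I, G.base D₀ v + (G.cut I : ℝ) / 2 := by
    intro I
    rw [h.degOn_eq, cut_eq, add_sub_cancel_left, Finset.sum_div, ← Finset.sum_add_distrib, gain]
    refine Finset.sum_congr rfl fun e _ => ?_
    split_ifs <;> simp [a, b] <;> ring
  have hcompl : ∀ I : Finset V, G.gain a b Iᶜ ≤
      ∑ v ∈ I, G.base D₀ v - (G.degOn D I : ℝ) + (G.cut I : ℝ) / 2 := by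
    intro I
    rw [h.degOn_eq, cut_eq, sub_add_cancel_left, Finset.sum_div, ← Finset.sum_neg_distrib,
      ← Finset.sum_add_distrib, gain]
    refine Finset.sum_le_sum fun e _ => ?_
    have : (a e : ℝ) ≤ b e := Int.cast_le.2 (Int.floor_le_ceil _)
    by_cases h : G.head e ∈ I <;> by_cases t : G.tail e ∈ I <;> simp [h, t] <;>
      simp only [a, b] at this ⊢ <;> first | linarith | exact Int.floor_le_ceil _
  have hdeg : (G.deg D : ℝ) = ∑ v, G.base D₀ v := by
    rw [← degOn_univ, h.degOn_eq]; simp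
  ext q
  simp only [semistabilityPolytope, IsSemistable, degreeSpace, cutCell, mem_ofPred_eq, hdeg,
    Finset.sum_sub_distrib, sub_eq_zero]
  refine and_congr_right fun hq => ⟨fun H I => ?_, fun H I _ _ => ?_⟩
  · rcases I.eq_empty_or_nonempty with rfl | hI
    · simp [gain]
    by_cases hu : I = Finset.univ
    · subst hu
      rw [gain_univ, hq, sub_self]
    · have := (abs_le.1 (H I hI hu)).1
      rw [hgain]; linarith
  · have h1 := H I
    have h2 := (H Iᶜ).trans (hcompl I)
    have h3 := Finset.sum_add_sum_compl I q
    have h4 := Finset.sum_add_sum_compl I (G.base D₀)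
    rw [hgain] at h1
    exact abs_le.2 ⟨by linarith, by linarith⟩

theorem pairing_add [Fintype V] (q f g : V → ℝ) :
    G.pairing D₀ q (fun v => f v + g v) = G.pairing D₀ q f + G.pairing D₀ q g := by
  simp [pairing, mul_add, Finset.sum_add_distrib]

theorem pairing_const [Fintype V] (q : V → ℝ) (k : ℝ) :
    G.pairing D₀ q (fun _ => k) = (∑ v, (q v - G.base D₀ v)) * k := by
  rw [pairing, Finset.sum_mul]

theorem energy_add_const (f : V → ℝ) (k : ℝ) :
    G.energy D₀ (fun v => f v + k) = G.energy D₀ f := by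
  simp [energy, slope_add_const]

/-- Only slopes of cut edges move, by `± ε / len e`. As `profile` is affine on each side of a point,
the first-order expansion is exact for small `ε`. -/
theorem energy_add_indicator (f : V → ℝ) (I : Finset V) :
    ∀ᶠ ε in 𝓝[>] (0 : ℝ), G.energy D₀ (fun v => f v + if v ∈ I then ε else 0) = G.energy D₀ f +
      ε * G.gain (fun e => ⌊G.slope D₀ f e⌋) (fun e => ⌈G.slope D₀ f e⌉) I := by
  have hdiv : ∀ e, Tendsto (fun ε => ε / G.len e) (𝓝[>] (0 : ℝ)) (𝓝[>] 0) := by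
    intro e
    have hl := G.len_pos e
    refine tendsto_nhdsWithin_iff.2 ⟨?_, ?_⟩
    · have : Tendsto (fun ε => ε / G.len e) (𝓝 (0 : ℝ)) (𝓝 (0 / G.len e)) :=
        (continuous_id.div_const _).tendsto 0
      rw [zero_div] at this
      exact this.mono_left nhdsWithin_le_nhds
    · filter_upwards [self_mem_nhdsWithin] with ε hε
      exact div_pos hε hl
  have h1 : ∀ᶠ ε in 𝓝[>] (0 : ℝ), ∀ e, profile (G.slope D₀ f e + ε / G.len e) =
      profile (G.slope D₀ f e) + (⌊G.slope D₀ f e⌋ + 1 / 2) * (ε / G.len e) :=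
    eventually_all.2 fun e => (hdiv e).eventually (profile_right _)
  have h2 : ∀ᶠ ε in 𝓝[>] (0 : ℝ), ∀ e, profile (G.slope D₀ f e - ε / G.len e) =
      profile (G.slope D₀ f e) - (⌈G.slope D₀ f e⌉ - 1 / 2) * (ε / G.len e) :=
    eventually_all.2 fun e => (hdiv e).eventually (profile_left _)
  filter_upwards [h1, h2] with ε h1 h2
  unfold energy gain
  rw [Finset.mul_sum, ← Finset.sum_add_distrib]
  refine Finset.sum_congr rfl fun e _ => ?_
  have hl := (G.len_pos e).ne'
  rw [slope_add]
  by_cases h : G.head e ∈ I <;> by_cases t : G.tail e ∈ I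
  · simp [h, t]
  · simp only [h, t, if_true, if_false, sub_zero, not_true, not_false_iff, and_true, and_false]
    rw [h1]; field_simp
  · simp only [h, t, if_true, if_false, zero_sub, not_true, not_false_iff, and_true, and_false,
      neg_div, ← sub_eq_add_neg]
    rw [h2]; field_simp; ring
  · simp [h, t]

/-- The subgradients of the energy are described by the inequalities for indicator functions. -/
theorem cell_eq_cutCell [Fintype V] (f : V → ℝ) : G.cell D₀ f =
    G.cutCell (G.base D₀) (fun e => ⌊G.slope D₀ f e⌋) (fun e => ⌈G.slope D₀ f e⌉) := by
  ext q
  constructor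
  · intro hq
    refine ⟨?_, fun I => ?_⟩
    · have h1 := hq (fun v => f v + 1)
      have h2 := hq (fun v => f v + (-1))
      rw [pairing_add, energy_add_const, pairing_const] at h1 h2
      linarith
    · obtain ⟨ε, hε, h0⟩ := ((energy_add_indicator (G := G) (D₀ := D₀) f I).and self_mem_nhdsWithin).exists
      have h0 : 0 < ε := h0
      have h1 := hq (fun v => f v + if v ∈ I then ε else 0)
      rw [pairing_add, hε] at h1
      have h2 : G.pairing D₀ q (fun v => if v ∈ I then ε else 0) =
          (∑ v ∈ I, (q v - G.base D₀ v)) * ε := by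
        rw [pairing, Finset.sum_mul]
        simp
      rw [h2] at h1
      by_contra hlt
      nlinarith [not_le.1 hlt]
  · rintro ⟨h0, hI⟩ g
    -- The inequalities on sets bound the pairing with `g - f` by the directional derivative of the
    -- energy, which convexity bounds by its increment.
    have key := sum_mul_le_of_threshold (V := V) (E := E) G.head G.tail (fun v => q v - G.base D₀ v)
      (fun e => (⌊G.slope D₀ f e⌋ : ℝ) + 1 / 2) (fun e => (⌈G.slope D₀ f e⌉ : ℝ) - 1 / 2) h0
      (fun I => hI I) (fun v => g v - f v)
    have h1 : G.pairing D₀ q g = G.pairing D₀ q f +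
        ∑ v, (q v - G.base D₀ v) * (g v - f v) := by
      simp only [pairing, ← Finset.sum_add_distrib]
      exact Finset.sum_congr rfl fun v _ => by ring
    have h2 : G.energy D₀ f + ∑ e, (((⌊G.slope D₀ f e⌋ : ℝ) + 1 / 2) *
        max ((g (G.head e) - f (G.head e)) - (g (G.tail e) - f (G.tail e))) 0 -
          ((⌈G.slope D₀ f e⌉ : ℝ) - 1 / 2) *
        max ((g (G.tail e) - f (G.tail e)) - (g (G.head e) - f (G.head e))) 0) ≤
          G.energy D₀ g := by
      unfold energy
      rw [← Finset.sum_add_distrib]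
      refine Finset.sum_le_sum fun e _ => ?_
      have hl := G.len_pos e
      set w := (g (G.head e) - f (G.head e)) - (g (G.tail e) - f (G.tail e)) with hw
      have hx : G.slope D₀ g e = G.slope D₀ f e + w / G.len e := by
        rw [slope, slope, ← add_div]
        congr 1
        rw [hw]; ring
      have hneg : (g (G.tail e) - f (G.tail e)) - (g (G.head e) - f (G.head e)) = -w := by
        rw [hw]; ring
      have hm : ∀ y : ℝ, max y 0 = G.len e * max (y / G.len e) 0 := fun y => by
        rw [mul_max_of_nonneg _ _ hl.le, mul_zero, mul_div_cancel₀ _ hl.ne']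
      rw [hneg, hm w, hm (-w), hx, neg_div]
      have := mul_le_mul_of_nonneg_left (profile_add_le (G.slope D₀ f e) (w / G.len e)) hl.le
      linarith
    linarith

end Cells

/-! ### Nonemptiness, boundedness and common faces of cells -/

section Polytope

variable [Fintype V] [Fintype E] {G : GraphModel V E} {D₀ : G.Divisor}

theorem sum_headSum_sub_tailSum_mul (s : E → ℝ) (f : V → ℝ) :
    ∑ v, (G.headSum s v - G.tailSum s v) * f v = ∑ e, s e * (f (G.head e) - f (G.tail e)) := by
  simp only [sub_mul, headSum, tailSum, Finset.sum_sub_distrib, Finset.sum_mul, mul_sub]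
  congr 1 <;> rw [Finset.sum_comm] <;> simp

/-- Taking the right derivative of `profile` on each edge, heads minus tails, produces a
subgradient. -/
theorem cell_nonempty (f : V → ℝ) : (G.cell D₀ f).Nonempty := by
  set s : E → ℝ := fun e => ⌊G.slope D₀ f e⌋ + 1 / 2 with hs
  refine ⟨fun v => G.base D₀ v + (G.headSum s v - G.tailSum s v), fun g => ?_⟩
  simp only [pairing, add_sub_cancel_left, sum_headSum_sub_tailSum_mul, energy,
    ← Finset.sum_sub_distrib]
  refine Finset.sum_le_sum fun e _ => ?_
  have := mul_le_mul_of_nonneg_left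
    (profile_subgradient (G.slope D₀ f e) (G.slope D₀ g e)) (G.len_pos e).le
  have h1 := G.len_mul_slope D₀ f e
  have h2 := G.len_mul_slope D₀ g e
  have h3 : G.len e * ((⌊G.slope D₀ f e⌋ + 1 / 2) * (G.slope D₀ g e - G.slope D₀ f e)) =
      s e * ((g (G.head e) - g (G.tail e)) - (f (G.head e) - f (G.tail e))) := by
    simp only [hs]
    linear_combination (⌊G.slope D₀ f e⌋ + 1 / 2 : ℝ) * (h2 - h1)
  linarith

theorem isPolytope_cutCell {c : V → ℝ} {a b : E → ℤ} (h : (G.cutCell c a b).Nonempty) :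
    IsPolytope (G.cutCell c a b) := by
  refine ⟨h, ?_, ?_⟩
  -- Singletons bound the coordinates from above; their complements bound them from below since the
  -- total is fixed.
  · refine (Metric.isBounded_Icc (fun v => c v - G.gain a b {v}ᶜ)
      (fun v => c v + G.gain a b {v})).subset fun q hq => ⟨fun v => ?_, fun v => ?_⟩
    · have h1 := hq.2 {v}ᶜ
      have h2 := Finset.sum_add_sum_compl {v} fun v => q v - c v
      rw [hq.1, Finset.sum_singleton] at h2
      simp only
      linarith
    · have h1 := hq.2 {v}
      rw [Finset.sum_singleton] at h1
      simp only
      linarith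
  · let ℓ : Finset V → (V → ℝ) →ₗ[ℝ] ℝ := fun I => ∑ v ∈ I, LinearMap.proj v
    have hℓ : ∀ I q, ℓ I q = ∑ v ∈ I, q v := fun I q => by simp [ℓ]
    -- One half of the equation on the total is the inequality for `univ`, where `gain` is `0`; only
    -- the other half is added.
    refine ⟨insert (-ℓ Finset.univ, -∑ v, c v)
      (Set.range fun I => (ℓ I, G.gain a b I + ∑ v ∈ I, c v)), (Set.finite_range _).insert _, ?_⟩
    ext q
    simp only [cutCell, mem_ofPred_eq, mem_insert_iff, mem_range, forall_eq_or_imp,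
      forall_exists_index, forall_apply_eq_imp_iff, LinearMap.neg_apply, hℓ,
      Finset.sum_sub_distrib, neg_le_neg_iff, sub_le_iff_le_add]
    refine ⟨fun H => ⟨by linarith [H.1], H.2⟩, fun H => ⟨?_, H.2⟩⟩
    have := H.2 Finset.univ
    rw [gain_univ] at this
    linarith [H.1]

/-- On `cell D₀ f` the pairing with `g - f` is at most `energy g - energy f`, with equality exactly
on `cell D₀ g`. If the cells meet, the common points are thus the maximizers. -/
theorem isExposed_cell_inter (f g : V → ℝ) :
    IsExposed ℝ (G.cell D₀ f) (G.cell D₀ f ∩ G.cell D₀ g) := by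
  rintro ⟨q₀, hf₀, hg₀⟩
  let ℓ : StrongDual ℝ (V → ℝ) := ∑ v, (g v - f v) • ContinuousLinearMap.proj v
  have hℓ : ∀ q, ℓ q = G.pairing D₀ q g - G.pairing D₀ q f +
      ∑ v, (g v - f v) * G.base D₀ v := fun q => by
    simp only [ℓ, pairing, _root_.sum_apply, _root_.smul_apply,
      ContinuousLinearMap.proj_apply, smul_eq_mul, ← Finset.sum_sub_distrib,
      ← Finset.sum_add_distrib]
    exact Finset.sum_congr rfl fun v _ => by ring
  refine ⟨ℓ, Set.ext fun q => ⟨fun ⟨hf, hg⟩ => ⟨hf, fun y hy => ?_⟩, fun ⟨hf, hmax⟩ => ⟨hf, ?_⟩⟩⟩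
  · have h1 := hy g
    have h2 := hg f
    rw [hℓ, hℓ]
    linarith
  · have h1 := hmax q₀ hf₀
    have h2 := hg₀ f
    rw [hℓ, hℓ] at h1
    intro k
    have h3 := hf k
    linarith

end Polytope

/-! ### Growth of the energy, covering and local finiteness -/

section Coercivity

variable {G : GraphModel V E} {D₀ : G.Divisor}

theorem IsConnected.eq_of_forall_edge (hG : G.IsConnected) {f : V → ℝ}
    (hf : ∀ e, f (G.head e) = f (G.tail e)) (u v : V) : f u = f v := by
  obtain ⟨p⟩ := hG.preconnected u v
  induction p with
  | nil => rfl
  | cons h _ ih =>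
    refine Eq.trans ?_ ih
    rw [SimpleGraph.fromRel_adj] at h
    rcases h.2 with ⟨e, rfl, rfl⟩ | ⟨e, rfl, rfl⟩
    · exact (hf e).symm
    · exact hf e

variable [Fintype E]

theorem energy_nonneg (f : V → ℝ) : 0 ≤ G.energy D₀ f :=
  Finset.sum_nonneg fun e _ => mul_nonneg (G.len_pos e).le
    ((by positivity : (0 : ℝ) ≤ _).trans (sq_le_profile _))

theorem continuous_energy : Continuous (G.energy D₀) := by
  refine continuous_finsetSum _ fun e _ => continuous_const.mul (continuous_profile.comp ?_)
  unfold slope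
  fun_prop

variable [Fintype V]

/-- By connectedness, the linear map sending `f` to its edge differences and `f v₀` is injective,
hence bounded below in finite dimension. -/
theorem exists_norm_le_of_isConnected (hG : G.IsConnected) (v₀ : V) : ∃ K : ℝ, 0 < K ∧
    ∀ f : V → ℝ, f v₀ = 0 → ‖f‖ ≤ K * ‖fun e => f (G.head e) - f (G.tail e)‖ := by
  let T : (V → ℝ) →ₗ[ℝ] (E → ℝ) × ℝ :=
    { toFun := fun f => (fun e => f (G.head e) - f (G.tail e), f v₀)
      map_add' := fun f g => Prod.ext (funext fun e => add_sub_add_comm _ _ _ _) rfl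
      map_smul' := fun k f => Prod.ext (funext fun e => (mul_sub k _ _).symm) rfl }
  have hT : ∀ f, T f = (fun e => f (G.head e) - f (G.tail e), f v₀) := fun f => rfl
  have hker : LinearMap.ker T = ⊥ := by
    rw [LinearMap.ker_eq_bot']
    intro f hf
    rw [hT, Prod.mk_eq_zero] at hf
    ext v
    rw [hG.eq_of_forall_edge (fun e => sub_eq_zero.1 (congrFun hf.1 e)) v v₀, hf.2]
    rfl
  obtain ⟨K, hK, h⟩ := T.exists_antilipschitzWith hker
  refine ⟨K, hK, fun f hf => ?_⟩
  have := h.le_mul_dist f 0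
  rwa [map_zero, dist_zero_right, dist_zero_right, hT, hf, Prod.norm_mk, norm_zero,
    max_eq_left (norm_nonneg _)] at this

/-- Since `profile x ≥ x² / 2`, the energy controls the squares of all edge differences. -/
theorem exists_sq_norm_le_energy (hG : G.IsConnected) (D₀ : G.Divisor) (v₀ : V) : ∃ C : ℝ, 0 < C ∧
    ∀ f : V → ℝ, f v₀ = 0 → ‖f‖ ^ 2 ≤ C * (G.energy D₀ f + 1) := by
  obtain ⟨K, hK, h⟩ := exists_norm_le_of_isConnected hG v₀
  set A := ∑ e, (4 * G.len e + 2 * G.edgeSum e id D₀ ^ 2) with hA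
  have hterm : ∀ e, 0 ≤ 4 * G.len e + 2 * G.edgeSum e id D₀ ^ 2 := fun e => by
    have := (G.len_pos e).le
    positivity
  have hA0 : 0 ≤ A := Finset.sum_nonneg fun e _ => hterm e
  refine ⟨K ^ 2 * (A + 1), by positivity, fun f hf => ?_⟩
  have hen := energy_nonneg (D₀ := D₀) f
  have hd : ‖fun e => f (G.head e) - f (G.tail e)‖ ≤ √((A + 1) * (G.energy D₀ f + 1)) := by
    refine (pi_norm_le_iff_of_nonneg (Real.sqrt_nonneg _)).2 fun e => ?_
    rw [Real.norm_eq_abs]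
    refine Real.abs_le_sqrt ?_
    have hl := G.len_pos e
    have h1 : G.len e * (G.slope D₀ f e ^ 2 / 2) ≤ G.energy D₀ f :=
      (mul_le_mul_of_nonneg_left (sq_le_profile _) hl.le).trans
        (Finset.single_le_sum (f := fun e => G.len e * profile (G.slope D₀ f e))
          (fun e _ => mul_nonneg (G.len_pos e).le
            ((by positivity : (0 : ℝ) ≤ _).trans (sq_le_profile _))) (Finset.mem_univ e))
    have h2 : 4 * G.len e + 2 * G.edgeSum e id D₀ ^ 2 ≤ A :=
      Finset.single_le_sum (f := fun e => 4 * G.len e + 2 * G.edgeSum e id D₀ ^ 2)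
        (fun e _ => hterm e) (Finset.mem_univ e)
    have h3 := G.len_mul_slope D₀ f e
    have h4 : f (G.head e) - f (G.tail e) =
        G.len e * G.slope D₀ f e - G.edgeSum e id D₀ := by linarith
    rw [h4]
    set M := G.edgeSum e id D₀
    set x := G.slope D₀ f e
    have h5 : (G.len e * x - M) ^ 2 ≤ 4 * G.len e * (G.len e * (x ^ 2 / 2)) + 2 * M ^ 2 := by
      nlinarith [sq_nonneg (G.len e * x + M)]
    have h6 : 4 * G.len e * (G.len e * (x ^ 2 / 2)) ≤ 4 * G.len e * G.energy D₀ f :=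
      mul_le_mul_of_nonneg_left h1 (by positivity)
    have h7 : (4 * G.len e + 2 * M ^ 2) * (G.energy D₀ f + 1) ≤
        (A + 1) * (G.energy D₀ f + 1) := mul_le_mul_of_nonneg_right (by linarith) (by linarith)
    have h8 : 0 ≤ 2 * M ^ 2 * G.energy D₀ f := by positivity
    nlinarith
  have h1 := (h f hf).trans (mul_le_mul_of_nonneg_left hd hK.le)
  calc ‖f‖ ^ 2 ≤ (K * √((A + 1) * (G.energy D₀ f + 1))) ^ 2 := by gcongr
    _ = K ^ 2 * (A + 1) * (G.energy D₀ f + 1) := by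
      rw [mul_pow, Real.sq_sqrt (by positivity)]; ring

theorem pairing_le (q f : V → ℝ) :
    G.pairing D₀ q f ≤ (∑ v, |q v - G.base D₀ v|) * ‖f‖ := by
  rw [pairing, Finset.sum_mul]
  refine Finset.sum_le_sum fun v _ => (le_abs_self _).trans ?_
  rw [abs_mul]
  exact mul_le_mul_of_nonneg_left (norm_le_pi_norm f v) (abs_nonneg _)

/-- The sublevel sets of the energy tilted by a linear form are bounded modulo constants. -/
theorem exists_norm_le (hG : G.IsConnected) (D₀ : G.Divisor) (v₀ : V) (P : ℝ) : ∃ R : ℝ, 0 ≤ R ∧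
    ∀ q : V → ℝ, ∑ v, |q v - G.base D₀ v| ≤ P → ∀ f : V → ℝ, f v₀ = 0 →
      G.energy D₀ f - G.pairing D₀ q f ≤ G.energy D₀ (fun _ => 0) → ‖f‖ ≤ R := by
  obtain ⟨C, hC, h⟩ := exists_sq_norm_le_energy hG D₀ v₀
  have he0 := energy_nonneg (G := G) (D₀ := D₀) (fun _ => 0)
  set e₀ := G.energy D₀ (fun _ => 0)
  -- The term `1` forces `‖f‖ > 1` outside the ball; dividing the quadratic bound by `‖f‖` then
  -- gives `‖f‖ ≤ C * (e₀ + 1) + C * max P 0`, a contradiction.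
  refine ⟨1 + C * (e₀ + 1) + C * max P 0, by positivity, fun q hq f hf hle => ?_⟩
  by_contra hlt
  rw [not_le] at hlt
  have h1 := h f hf
  have h2 := pairing_le (G := G) (D₀ := D₀) q f
  have h3 : (∑ v, |q v - G.base D₀ v|) * ‖f‖ ≤ max P 0 * ‖f‖ :=
    mul_le_mul_of_nonneg_right (hq.trans (le_max_left _ _)) (norm_nonneg _)
  have h4 : ‖f‖ ^ 2 ≤ C * (e₀ + max P 0 * ‖f‖ + 1) :=
    h1.trans (mul_le_mul_of_nonneg_left (by linarith) hC.le)
  have h5 : 0 ≤ C * (e₀ + 1) := by positivity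
  have h6 : 0 ≤ C * max P 0 := by positivity
  have h7 : 1 < ‖f‖ := by linarith
  nlinarith [mul_le_mul_of_nonneg_left h7.le h5,
    mul_lt_mul_of_pos_right hlt (zero_lt_one.trans h7)]

theorem energy_sub_pairing_add_const {q : V → ℝ} (hq : ∑ v, (q v - G.base D₀ v) = 0) (f : V → ℝ)
    (k : ℝ) : G.energy D₀ (fun v => f v + k) - G.pairing D₀ q (fun v => f v + k) =
      G.energy D₀ f - G.pairing D₀ q f := by
  rw [energy_add_const, pairing_add, pairing_const, hq]; ring

/-- A minimiser over a compact ball of functions vanishing at `v₀` is global: outside the ball the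
tilted energy exceeds its value at `0`, and constants do not change it. -/
theorem exists_mem_cell (hG : G.IsConnected) {q : V → ℝ} (hq : ∑ v, (q v - G.base D₀ v) = 0) :
    ∃ f, q ∈ G.cell D₀ f := by
  obtain ⟨v₀⟩ := hG.nonempty
  obtain ⟨R, hR, h⟩ := exists_norm_le hG D₀ v₀ (∑ v, |q v - G.base D₀ v|)
  have hcomp : IsCompact ({f : V → ℝ | f v₀ = 0} ∩ Metric.closedBall 0 R) :=
    (isCompact_closedBall 0 R).inter_left (isClosed_eq (continuous_apply v₀) continuous_const)
  have hcont : Continuous fun f => G.energy D₀ f - G.pairing D₀ q f := by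
    refine continuous_energy.sub ?_
    unfold pairing
    fun_prop
  obtain ⟨f, -, hf⟩ := hcomp.exists_isMinOn ⟨fun _ => 0, rfl, by
    change (0 : V → ℝ) ∈ _
    simpa using hR⟩ hcont.continuousOn
  have hz : G.pairing D₀ q (fun _ => 0) = 0 := by simp [pairing]
  refine ⟨f, fun g => ?_⟩
  rw [← energy_sub_pairing_add_const hq g (-g v₀)]
  set g' : V → ℝ := fun v => g v + -g v₀
  have hg' : g' v₀ = 0 := by simp [g']
  by_cases hle : ‖g'‖ ≤ R
  · exact hf ⟨hg', by simpa using hle⟩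
  · have h0 : G.energy D₀ f - G.pairing D₀ q f ≤
        G.energy D₀ (fun _ => 0) - G.pairing D₀ q (fun _ => 0) := hf ⟨rfl, by
      change (0 : V → ℝ) ∈ _
      simpa using hR⟩
    have h1 : G.energy D₀ (fun _ => 0) < G.energy D₀ g' - G.pairing D₀ q g' := by
      by_contra hc
      exact hle (h q le_rfl g' hg' (not_lt.1 hc))
    rw [hz] at h0
    linarith

/-- Comparison with the zero function puts the normalised `f` of every such cell in one ball, where
floors and ceilings of slopes take finitely many values. -/
theorem finite_cells_meeting (hG : G.IsConnected) (D₀ : G.Divisor) {K : Set (V → ℝ)}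
    (hK : Bornology.IsBounded K) :
    {P ∈ Set.range (G.cell D₀) | (P ∩ K).Nonempty}.Finite := by
  obtain ⟨v₀⟩ := hG.nonempty
  obtain ⟨B, hB⟩ := hK.exists_norm_le
  obtain ⟨R, hR, h⟩ := exists_norm_le hG D₀ v₀ (∑ v, (B + |G.base D₀ v|))
  have hslope : ∀ e, ∃ n : ℤ, ∀ f : V → ℝ, ‖f‖ ≤ R →
      -n ≤ ⌊G.slope D₀ f e⌋ ∧ ⌈G.slope D₀ f e⌉ ≤ n := by
    intro e
    have hl := G.len_pos e
    refine ⟨⌈(2 * R + |G.edgeSum e id D₀|) / G.len e⌉, fun f hf => ?_⟩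
    have h1 := abs_le.1 ((norm_le_pi_norm f (G.head e)).trans hf)
    have h2 := abs_le.1 ((norm_le_pi_norm f (G.tail e)).trans hf)
    have h3 := abs_le.1 (le_refl |G.edgeSum e id D₀|)
    rw [← Int.floor_neg, ← neg_div]
    refine ⟨Int.floor_le_floor ?_, Int.ceil_le_ceil ?_⟩ <;>
    · unfold slope
      refine div_le_div_of_nonneg_right ?_ hl.le
      linarith
  choose n hn using hslope
  refine (((Set.finite_Icc (-n) n).prod (Set.finite_Icc (-n) n)).image
    fun ab => G.cutCell (G.base D₀) ab.1 ab.2).subset ?_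
  rintro _ ⟨⟨f, rfl⟩, q, hqf, hqK⟩
  set g : V → ℝ := fun v => f v + -f v₀ with hg
  have hcell : G.cell D₀ f = G.cell D₀ g := by
    rw [cell_eq_cutCell, cell_eq_cutCell]
    simp only [hg, slope_add_const]
  rw [hcell] at hqf ⊢
  have hq : ∑ v, |q v - G.base D₀ v| ≤ ∑ v, (B + |G.base D₀ v|) :=
    Finset.sum_le_sum fun v _ => (abs_sub _ _).trans
      (by gcongr; exact (norm_le_pi_norm q v).trans (hB q hqK))
  have hgR : ‖g‖ ≤ R := h q hq g (by simp [hg]) (by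
    have := hqf fun _ => 0
    have hz : G.pairing D₀ q (fun _ => 0) = 0 := by simp [pairing]
    linarith)
  have hfc : ∀ e, ⌊G.slope D₀ g e⌋ ≤ ⌈G.slope D₀ g e⌉ := fun e => Int.floor_le_ceil _
  exact ⟨(fun e => ⌊G.slope D₀ g e⌋, fun e => ⌈G.slope D₀ g e⌉),
    ⟨⟨fun e => (hn e g hgR).1, fun e => (hfc e).trans (hn e g hgR).2⟩,
      ⟨fun e => (hn e g hgR).1.trans (hfc e), fun e => (hn e g hgR).2⟩⟩,
    (cell_eq_cutCell g).symm⟩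

end Coercivity

/-! ### Independence of `Λ` and conclusion -/

section Rationality

variable [Fintype V] [Fintype E] {G : GraphModel V E} {D₀ : G.Divisor}

/-- The values of `f` are moved by small amounts depending only on their classes modulo `Λ`. If the
slope on `e` is integral, both ends of `e` have the same class and the slope does not change; any
other slope stays between the same two integers. -/
theorem exists_potential_mem {Λ : AddSubgroup ℝ} (hlen : ∀ e, G.len e ∈ Λ)
    (hdense : Dense (Λ : Set ℝ)) (hD₀ : G.IsLambdaRational Λ D₀) (f : V → ℝ) :
    ∃ f' : V → ℝ, (∀ v, f' v ∈ Λ) ∧ G.cell D₀ f' = G.cell D₀ f := by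
  have hM : ∀ e, G.edgeSum e id D₀ ∈ Λ := fun e => edgeSum_mem Λ fun t ht => hD₀ e t ht
  have hopen : IsOpen {g : V → ℝ | ∀ e, (⌊G.slope D₀ f e⌋ : ℝ) < G.slope D₀ f e →
      (⌊G.slope D₀ f e⌋ : ℝ) < G.slope D₀ g e ∧ G.slope D₀ g e < ⌊G.slope D₀ f e⌋ + 1} := by
    simp only [Set.ofPred_forall]
    refine isOpen_iInter_of_finite fun e => isOpen_iInter_of_finite fun _ => ?_
    have hc : Continuous fun g => G.slope D₀ g e := by unfold slope; fun_prop
    exact (isOpen_lt continuous_const hc).inter (isOpen_lt hc continuous_const)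
  obtain ⟨ε, hε, hball⟩ := Metric.isOpen_iff.1 hopen f fun e he => ⟨he, Int.lt_floor_add_one _⟩
  have hδ : ∀ c : ℝ ⧸ Λ, ∃ δ : ℝ, |δ| < ε ∧ c.out + δ ∈ Λ := by
    intro c
    obtain ⟨y, hy, hyε⟩ := Metric.dense_iff.1 hdense c.out ε hε
    refine ⟨y - c.out, by simpa [Real.dist_eq] using hy, by simpa using hyε⟩
  choose δ hδε hδΛ using hδ
  refine ⟨fun v => f v + δ (f v), fun v => ?_, ?_⟩
  · have h1 : -(f v) + (f v : ℝ ⧸ Λ).out ∈ Λ :=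
      QuotientAddGroup.eq.1 (Quotient.out_eq' (f v : ℝ ⧸ Λ)).symm
    have h2 := sub_mem (hδΛ (f v)) h1
    convert h2 using 1
    ring
  · set f' : V → ℝ := fun v => f v + δ (f v) with hf'
    have hmem : f' ∈ Metric.ball f ε := by
      rw [Metric.mem_ball, dist_pi_lt_iff hε]
      intro v
      simpa [hf', Real.dist_eq] using hδε (f v)
    have hfc : ∀ e, ⌊G.slope D₀ f' e⌋ = ⌊G.slope D₀ f e⌋ ∧ ⌈G.slope D₀ f' e⌉ = ⌈G.slope D₀ f e⌉ := by
      intro e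
      rcases (Int.floor_le (G.slope D₀ f e)).eq_or_lt with h0 | h0
      · have h1 : (f (G.tail e) : ℝ ⧸ Λ) = f (G.head e) := by
          refine QuotientAddGroup.eq.2 ?_
          have h2 := G.len_mul_slope D₀ f e
          rw [← h0, mul_comm, ← zsmul_eq_mul] at h2
          have h3 := sub_mem (Λ.zsmul_mem (hlen e) ⌊G.slope D₀ f e⌋) (hM e)
          rw [h2] at h3
          convert h3 using 1
          ring
        have : G.slope D₀ f' e = G.slope D₀ f e := by
          unfold slope
          simp only [hf', h1]
          ring
        rw [this]
        exact ⟨rfl, rfl⟩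
      · obtain ⟨h1, h2⟩ := hball hmem e h0
        refine ⟨Int.floor_eq_iff.2 ⟨h1.le, h2⟩, ?_⟩
        have h3 : ⌈G.slope D₀ f e⌉ = ⌊G.slope D₀ f e⌋ + 1 := Int.ceil_eq_iff.2
          ⟨by push_cast; linarith, by push_cast; linarith [Int.lt_floor_add_one (G.slope D₀ f e)]⟩
        rw [h3]
        exact Int.ceil_eq_iff.2 ⟨by push_cast; linarith, by push_cast; linarith⟩
    rw [cell_eq_cutCell, cell_eq_cutCell]
    simp only [hfc]

theorem semistabilityTiles_eq_range_cell {L : Set G.Divisor} {Λ : AddSubgroup ℝ}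
    (hlen : ∀ e, G.len e ∈ Λ) (hdense : Dense (Λ : Set ℝ)) (hL : L = {D | G.LinEquiv D D₀})
    (hD₀ : G.IsLambdaRational Λ D₀) : G.semistabilityTiles L Λ = Set.range (G.cell D₀) := by
  subst hL
  ext P
  constructor
  · rintro ⟨D, hD, hadm, -, rfl⟩
    obtain ⟨f, hf⟩ := LinEquiv.exists_hasPotential hD hadm
    exact ⟨f, by rw [hf.semistabilityPolytope_eq, cell_eq_cutCell]⟩
  · rintro ⟨f, rfl⟩
    obtain ⟨f', hf', hcell⟩ := exists_potential_mem hlen hdense hD₀ f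
    obtain ⟨D, hD, hadm, hpot, hval⟩ := exists_admissible_hasPotential D₀ f'
    refine ⟨D, hD, hadm, fun e t ht => ?_, ?_⟩
    · have h1 := G.len_mul_slope D₀ f' e
      have h2 : G.len e * Int.fract (G.slope D₀ f' e) = f' (G.head e) - f' (G.tail e) +
          G.edgeSum e id D₀ - ⌊G.slope D₀ f' e⌋ • G.len e := by
        rw [zsmul_eq_mul, ← h1, Int.fract]; ring
      rw [hval e t ht, h2]
      exact sub_mem (add_mem (sub_mem (hf' _) (hf' _)) (edgeSum_mem Λ fun t ht => hD₀ e t ht))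
        (Λ.zsmul_mem (hlen e) _)
    · rw [hpot.semistabilityPolytope_eq, ← cell_eq_cutCell, hcell]

theorem isTiling_range_cell (hG : G.IsConnected) (D₀ : G.Divisor) :
    IsTiling (Set.range (G.cell D₀)) (degreeSpace V (G.deg D₀)) where
  isPolytope := by
    rintro _ ⟨f, rfl⟩
    have := cell_nonempty (D₀ := D₀) f
    rw [cell_eq_cutCell] at this ⊢
    exact isPolytope_cutCell this
  sUnion_eq := by
    have hq : ∀ q : V → ℝ, q ∈ degreeSpace V (G.deg D₀) ↔ ∑ v, (q v - G.base D₀ v) = 0 :=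
      fun q => by rw [degreeSpace, mem_ofPred_eq, Finset.sum_sub_distrib, sum_base, sub_eq_zero]
    ext q
    rw [hq]
    constructor
    · rintro ⟨_, ⟨f, rfl⟩, h⟩
      rw [cell_eq_cutCell] at h
      exact h.1
    · intro h
      obtain ⟨f, hf⟩ := exists_mem_cell hG h
      exact ⟨_, ⟨f, rfl⟩, hf⟩
  common_face := by
    rintro _ ⟨f, rfl⟩ _ ⟨g, rfl⟩
    refine ⟨isExposed_cell_inter f g, ?_⟩
    rw [inter_comm]
    exact isExposed_cell_inter g f
  locallyFinite := fun _ hK => finite_cells_meeting hG D₀ hK.isBounded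

/-- Every admissible divisor of `L` has a potential, so its polytope is a cell, and the tiles for
`Λ` are all the cells. Exchanging `Λ` and `Λ'` gives equality. -/
theorem IsLinearClass.semistabilityTiles_subset {d : ℤ} {L : Set G.Divisor}
    (hL : G.IsLinearClass d L) {Λ Λ' : AddSubgroup ℝ} (hlen : ∀ e, G.len e ∈ Λ)
    (hdense : Dense (Λ : Set ℝ)) (hne : ∃ D ∈ L, G.IsLambdaRational Λ D) :
    G.semistabilityTiles L Λ' ⊆ G.semistabilityTiles L Λ := by
  obtain ⟨D₀, hD₀, hrat⟩ := hne
  obtain ⟨-, hL'⟩ := hL.eq_of_mem hD₀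
  rw [semistabilityTiles_eq_range_cell hlen hdense hL' hrat]
  rintro _ ⟨D, hD, hadm, -, rfl⟩
  rw [hL'] at hD
  obtain ⟨f, hf⟩ := LinEquiv.exists_hasPotential hD hadm
  exact ⟨f, by rw [hf.semistabilityPolytope_eq, cell_eq_cutCell]⟩

end Rationality

end GraphModel

theorem mainTheorem1 {V E : Type*} [Fintype V] [Fintype E] (G : GraphModel V E)
    (hG : G.IsConnected) (d : ℤ) (L : Set G.Divisor) (hL : G.IsLinearClass d L)
    (Λ : AddSubgroup ℝ) (hlen : ∀ e, G.len e ∈ Λ) (hdense : Dense (Λ : Set ℝ))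
    (hne : ∃ D ∈ L, G.IsLambdaRational Λ D) :
    IsTiling (G.semistabilityTiles L Λ) (GraphModel.degreeSpace V d) ∧
      ∀ Λ' : AddSubgroup ℝ, (∀ e, G.len e ∈ Λ') → Dense (Λ' : Set ℝ) →
        (∃ D ∈ L, G.IsLambdaRational Λ' D) →
        G.semistabilityTiles L Λ' = G.semistabilityTiles L Λ := by
  refine ⟨?_, fun Λ' hlen' hdense' hne' =>
    (hL.semistabilityTiles_subset hlen hdense hne).antisymm
      (hL.semistabilityTiles_subset hlen' hdense' hne')⟩
  obtain ⟨D₀, hD₀, hrat⟩ := hne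
  obtain ⟨rfl, hL'⟩ := hL.eq_of_mem hD₀
  rw [GraphModel.semistabilityTiles_eq_range_cell hlen hdense hL' hrat]
  exact GraphModel.isTiling_range_cell hG D₀
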